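/- For each $n\ge 1$ let $\rho_n\in(0,1]$, and assume that $\rho_n>1-\frac{\log\log n}{18\log n}$ for all large $n$. Let $\theta_1,\theta_2,\dots$ be independent random $n\times n$ matrices such that the columns of each $\theta_t$ are independent centered Gaussian vectors with all variances equal to $1$ and all pairwise covariances equal to $\rho_n$. For $\omega\in\{-1,1\}^n$ put $\omega_0=\omega$ and $\omega_t=\mathrm{sign}(\theta_t\,\omega_{t-1})$ (coordinatewise) for $t\ge 1$. For two inputs $\omega,\eta\in\{-1,1\}^n$, fed into the same network, let $\tilde D_t=\frac1n\,|\{i:\omega_t(i)\ne\eta_t(i)\}|$. (i) Let $T_n$ be positive integers with $T_n\ge(\log n)^{1/4}$ for all large $n$. For every $\delta>0$ and all sufficiently small $\varepsilon>0$, for any inputs $\omega=\omega^{(n)}$, $\eta=\eta^{(n)}$ with $\tilde D_0<\varepsilon^2/2$ for all large $n$, $$\limsup_{n\to\infty}\mathrm P\Big(\{\tilde D_{T_n}>0\}\cup\Big\{\exists\,t\in\{1,\dots,T_n\}:\tilde D_t>\frac{\varepsilon^2}{2}\Big\}\Big)<\delta ,$$ and in particular $$\limsup_{n\to\infty}\mathrm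 P\Big(\exists\,t\ge 1:\tilde D_t>\frac{\varepsilon^2}{2}\Big)<\delta .$$ (ii) Let $h_n:\{-1,1\}^n\to\{-1,1\}$ be Boolean functions, let $T_n\ge 1$ be integers, and let $f_{n,T_n}(\omega)=h_n(\omega_{T_n})$, a random Boolean function. Suppose that either $T_n\ge(\log n)^{1/4}$ for all large $n$, or $(h_n)$ has a sharp threshold at $1/2$, meaning that whenever the bits of $\omega$ are independent and equal to $1$ with probability $p_n$, where $p_n-\frac12$ is bounded away from $0$, then $\mathrm P(h_n(\omega)=\mathrm{sign}(p_n-\frac12))\to1$. Then, with $\omega$ uniform on $\{-1,1\}^n$ and $\omega^\varepsilon$ obtained from $\omega$ by flipping each bit independently with probability $\varepsilon$, both independent of the network, $f_{n,T_n}$ is annealed noise stable, i.e. $$\lim_{\varepsilon\to0}\ \sup_n\ \mathrm P_{f,\omega,\omega^\varepsilon}\big(f_{n,T_n}(\omega)\ne f_{n,T_n}(\omega^\varepsilon)\big)=0,$$ and quenched noise stable, i.e. for every $\delta>0$ there is $\varepsilon>0$ such that for all $n$, with probability at least $1-\delta$ over the choice of $f_{n,T_n}$, one has $\mathrm P_{\omega,\omega^\varepsilon}\big(f_{n,T_n}(\omega)\ne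 f_{n,T_n}(\omega^\varepsilon)\big)<\delta$. -/

import Mathlib

open MeasureTheory ProbabilityTheory Filter Topology

noncomputable section

namespace NoisyNet

/-! ### The cube, Boolean functions and noise

The two-point set `{-1, 1}` is encoded by `Bool`: `true` is `+1` and `false` is `-1`. -/

/-- The discrete cube `{-1, 1}^n`. -/
abbrev Cube (n : ℕ) : Type := Fin n → Bool

/-- Boolean functions `{-1, 1}^n → {-1, 1}`. -/
abbrev BoolFn (n : ℕ) : Type := Cube n → Bool

/-- The numerical value `±1` of a bit. -/
def bit (b : Bool) : ℝ := if b then 1 else -1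

/-- The sign of a real number as a bit. The value at `0` is immaterial, since in the networks below
the sign is only taken of nondegenerate centered Gaussian variables (for `n ≥ 1`). -/
def signBit (x : ℝ) : Bool := decide (0 < x)

/-- The law on `{-1, 1}^n` under which the bits are independent and equal to `+1` with
probability `p`. -/
def bernoulliCube (n : ℕ) (p : unitInterval) : Measure (Cube n) :=
  Measure.pi fun _ => bernoulliMeasure true false p

/-- The uniform law on `{-1, 1}^n`. -/
def uniformCube (n : ℕ) : Measure (Cube n) :=
  bernoulliCube n ⟨1 / 2, by norm_num, by norm_num⟩

/-- The joint law of `(ω, ω^ε)`: `ω` is uniform and `ω^ε` is obtained from `ω` by flipping each bit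
independently with probability `ε`. -/
def noisePair (n : ℕ) (ε : unitInterval) : Measure (Cube n × Cube n) :=
  ((uniformCube n).prod (bernoulliCube n ε)).map
    fun q => (q.1, fun i => xor (q.1 i) (q.2 i))

/-- Annealed noise stability of a sequence `π_n` of laws on Boolean functions:
`lim_{ε → 0} sup_n P_{f, ω, ω^ε} (f ω ≠ f ω^ε) = 0`. -/
def AnnealedNoiseStable (π : ∀ n, Measure (BoolFn n)) : Prop :=
  Tendsto
    (fun ε : unitInterval =>
      ⨆ n, ((π n).prod (noisePair n ε)) {q | q.1 q.2.1 ≠ q.1 q.2.2})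
    (𝓝[>] 0) (𝓝 0)

/-- Quenched noise stability of a sequence `π_n` of laws on Boolean functions: for every `δ > 0`
there is `ε > 0` such that for all `n`,
`π_n {f : P_{ω, ω^ε} (f ω ≠ f ω^ε) < δ} ≥ 1 - δ`. -/
def QuenchedNoiseStable (π : ∀ n, Measure (BoolFn n)) : Prop :=
  ∀ δ : ℝ, 0 < δ → ∃ ε : unitInterval, 0 < ε ∧ ∀ n,
    1 - ENNReal.ofReal δ ≤
      π n {f | noisePair n ε {q | f q.1 ≠ f q.2} < ENNReal.ofReal δ}

/-- A sequence of Boolean functions has a sharp threshold at `1/2`: if the bits of `ω` are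
independent and `+1` with probability `p_n`, where `p_n - 1/2` is bounded away from `0`, then
`P (h_n ω = sign (p_n - 1/2)) → 1`. -/
def SharpThreshold (h : ∀ n, BoolFn n) : Prop :=
  ∀ p : ℕ → unitInterval,
    (∃ c : ℝ, 0 < c ∧ ∀ n, c ≤ |(p n : ℝ) - 1 / 2|) →
    Tendsto (fun n => bernoulliCube n (p n) {ω | h n ω = signBit ((p n : ℝ) - 1 / 2)})
      atTop (𝓝 1)

/-! ### The correlated Gaussian network -/

/-- The Gaussian variables of one layer of width `n`: the family `ν(j)` and the
family `ψ(i, j)`. -/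
abbrev LayerNoise (n : ℕ) : Type := (Fin n → ℝ) × (Fin n → Fin n → ℝ)

/-- All the variables `ν(j)`, `ψ(i, j)` of a layer are independent standard Gaussians. -/
def layerLaw (n : ℕ) : Measure (LayerNoise n) :=
  (Measure.pi fun _ => gaussianReal 0 1).prod
    (Measure.pi fun _ => Measure.pi fun _ => gaussianReal 0 1)

instance (n : ℕ) : IsProbabilityMeasure (layerLaw n) := by
  unfold layerLaw; infer_instance

/-- The law of an infinite sequence of independent layers. -/
def netLaw (n : ℕ) : Measure (ℕ → LayerNoise n) :=
  Measure.infinitePi fun _ => layerLaw n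

/-- The weight matrix `θ(i, j) = √ρ ν(j) + √(1 - ρ) ψ(i, j)`: the columns are independent, and each
column is a centered Gaussian vector with unit variances and all pairwise covariances `ρ`. -/
def weight {n : ℕ} (ρ : ℝ) (z : LayerNoise n) : Matrix (Fin n) (Fin n) ℝ :=
  fun i j => √ρ * z.1 j + √(1 - ρ) * z.2 i j

/-- One layer of the network: `ω ↦ sign (θ ω)`, coordinatewise. -/
def layer {n : ℕ} (ρ : ℝ) (z : LayerNoise n) (ω : Cube n) : Cube n :=
  fun i => signBit (∑ j, weight ρ z i j * bit (ω j))

/-- The state `ω_t` after `t` layers when the input is `ω_0 = ω`; `Θ t` holds the variables of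
layer `t + 1`. -/
def state {n : ℕ} (ρ : ℝ) (Θ : ℕ → LayerNoise n) (ω : Cube n) : ℕ → Cube n
  | 0 => ω
  | t + 1 => layer ρ (Θ t) (state ρ Θ ω t)

/-- The law `π_n` of the random Boolean function `f_{n, T} ω = h ω_T`. -/
def functionLaw (n : ℕ) (ρ : ℝ) (T : ℕ) (h : BoolFn n) : Measure (BoolFn n) :=
  (netLaw n).map fun Θ ω => h (state ρ Θ ω T)

/-- The proportion of coordinates in which two points of the cube disagree. -/
def disagreement {n : ℕ} (ω η : Cube n) : ℝ := (hammingDist ω η : ℝ) / n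

/-- The process of the proportion of disagreements between the layers of one and the same network,
run on the two inputs `ω` and `η`. It starts from `disagreement ω η`. -/
def disagreementProcess {n : ℕ} (ρ : ℝ) (ω η : Cube n) (Θ : ℕ → LayerNoise n) (t : ℕ) : ℝ :=
  disagreement (state ρ Θ ω t) (state ρ Θ η t)

end NoisyNet

end

namespace NoisyNet

/-! ### The standard Gaussian law on the line -/

/-! Bit `i` of a layer is the sign of `√ρ a + √(1 - ρ) b_i`, where the common part `a` and the
individual noises `b_i` are independent standard Gaussians. As `ρ` is close to `1`, almost all bits
follow the sign of `a`. For two inputs with proportion of disagreements `D`, the difference of the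
common parts is Gaussian of variance `4 D`. So both common parts have the same sign and size at
least `u`, unless the first is smaller than `u + w` or they differ by more than `w`. Outside these
events, bits disagree only where an individual noise is exceptionally large, and Markov's inequality
bounds their proportion. This is `layerLaw_le_disagreement_le`, the one estimate behind everything
on the decay of disagreements.

Put `x = (log n)^(1/12)` and `L = log log n`, so that `1 - ρ ≤ L / (18 x ^ 12)`. The estimate is
used in three regimes. (b) With `u`, `w` small constants, the first layer brings `D < r` down to at
most `x⁻²⁴`, up to a small error. (e) With `u = w = x⁻⁴`, each further layer keeps `D ≤ x⁻²⁴`, with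
error of order `x⁻⁴`; this remains small when summed over `x³` layers. (q) With `u² = L / 8`, the
common part is so large that, after a union bound over all `n` bits, no individual noise overturns
it. This has probability at least `c x⁻²`, and then the two states coincide forever. In `x³ = (log
n)^(1/4)` layers the survival probability is about `(1 - c x⁻²)^(x³)`, which tends to `0`. The
Markov property turns the three bounds into `b + k e + q ^ k` (`netLaw_exists_le`), and
`eventually_netLaw_le` collects the result.

For noise stability, noise of rate `ε` produces a proportion of disagreements of mean `ε`, so the
preceding bound applies to deep networks. For a sharp threshold function of any depth `T ≥ 1`, the
disagreements stay few up to layer `T - 1`. In the last layer the bits are i.i.d. given the common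
part, with a bias of the sign of `a`; the function reads off that sign, which is the same for both
inputs (`SharpThreshold.eventually_netLaw_le`). The quenched statement follows from the annealed one
by Markov's inequality. -/

lemma gaussianPDFReal_zero_one (x : ℝ) :
    gaussianPDFReal 0 1 x = (√(2 * Real.pi))⁻¹ * Real.exp (-x ^ 2 / 2) := by
  simp [gaussianPDFReal]

lemma gaussianReal_abs_lt_le (y : ℝ) :
    gaussianReal 0 1 {x | |x| < y} ≤ ENNReal.ofReal y := by
  have h1 : (1 : NNReal) ≠ 0 := one_ne_zero
  rw [gaussianReal_apply 0 h1]
  calc ∫⁻ x in {x | |x| < y}, gaussianPDF 0 1 x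
      ≤ ∫⁻ x in {x : ℝ | |x| < y}, ENNReal.ofReal (1 / 2) := by
        refine lintegral_mono fun x => ENNReal.ofReal_le_ofReal ?_
        rw [gaussianPDFReal_zero_one]
        have h2 : (2 : ℝ) ≤ √(2 * Real.pi) := by
          rw [Real.le_sqrt (by norm_num) (by positivity)]
          nlinarith [Real.pi_gt_three]
        have h3 : (√(2 * Real.pi))⁻¹ ≤ 1 / 2 := by
          rw [one_div]; exact inv_anti₀ (by norm_num) h2
        have h4 : Real.exp (-x ^ 2 / 2) ≤ 1 := Real.exp_le_one_iff.2 (by nlinarith [sq_nonneg x])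
        exact (mul_le_mul h3 h4 (Real.exp_pos _).le (by norm_num)).trans_eq (mul_one _)
    _ = ENNReal.ofReal y := by
        have : {x : ℝ | |x| < y} = Set.Ioo (-y) y := by ext x; simp [abs_lt]
        rw [setLIntegral_const, this, Real.volume_Ioo, ← ENNReal.ofReal_mul (by norm_num)]
        congr 1; ring

lemma le_gaussianReal_abs_ge {y : ℝ} (hy : 0 ≤ y) :
    ENNReal.ofReal ((√(2 * Real.pi))⁻¹ * Real.exp (-(y + 1) ^ 2 / 2)) ≤
      gaussianReal 0 1 {x | y ≤ |x|} := by
  have h1 : (1 : NNReal) ≠ 0 := one_ne_zero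
  calc _ = ∫⁻ x in Set.Icc y (y + 1),
        ENNReal.ofReal ((√(2 * Real.pi))⁻¹ * Real.exp (-(y + 1) ^ 2 / 2)) := by
        rw [setLIntegral_const, Real.volume_Icc]; simp
    _ ≤ ∫⁻ x in Set.Icc y (y + 1), gaussianPDF 0 1 x := by
        refine setLIntegral_mono (measurable_gaussianPDF 0 1) fun x hx => ?_
        refine ENNReal.ofReal_le_ofReal ?_
        rw [gaussianPDFReal_zero_one]
        have : x ^ 2 ≤ (y + 1) ^ 2 := by nlinarith [hx.1, hx.2]
        gcongr
    _ = gaussianReal 0 1 (Set.Icc y (y + 1)) := (gaussianReal_apply 0 h1 _).symm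
    _ ≤ _ := measure_mono fun x hx => hx.1.trans (le_abs_self x)

lemma gaussianReal_abs_ge_le {y : ℝ} (hy : 0 ≤ y) :
    gaussianReal 0 1 {x | y ≤ |x|} ≤ ENNReal.ofReal (2 * Real.exp (-y ^ 2 / 2)) := by
  have key : gaussianReal 0 1 {x | y ≤ x} ≤ ENNReal.ofReal (Real.exp (-y ^ 2 / 2)) := by
    have := measure_ge_le_exp_mul_mgf (μ := gaussianReal 0 1) (X := id) y hy
      (integrable_exp_mul_gaussianReal y)
    rw [mgf_id_gaussianReal, ← Real.exp_add] at this
    rw [← ENNReal.ofReal_toReal (measure_ne_top (gaussianReal 0 1) {x | y ≤ x})]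
    refine ENNReal.ofReal_le_ofReal (this.trans_eq ?_)
    congr 1; simp; ring
  have key2 : gaussianReal 0 1 {x | y ≤ -x} ≤ ENNReal.ofReal (Real.exp (-y ^ 2 / 2)) := by
    refine le_trans (le_of_eq ?_) key
    have : gaussianReal 0 1 = (gaussianReal 0 1).map (fun x => -x) := by
      rw [gaussianReal_map_neg, neg_zero]
    conv_rhs => rw [this, Measure.map_apply measurable_neg (measurableSet_le (by fun_prop) (by fun_prop))]
    rfl
  calc gaussianReal 0 1 {x | y ≤ |x|} ≤ gaussianReal 0 1 ({x | y ≤ x} ∪ {x | y ≤ -x}) :=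
        measure_mono fun x (hx : y ≤ |x|) => (le_abs.1 hx : y ≤ x ∨ y ≤ -x)
    _ ≤ _ := measure_union_le _ _
    _ ≤ _ := add_le_add key key2
    _ = _ := by rw [← ENNReal.ofReal_add (by positivity) (by positivity)]; congr 1; ring

/-- Chebyshev suffices here and also covers `v = 0`, which occurs when the two inputs coincide. -/
lemma gaussianReal_abs_gt_le {v : NNReal} {w : ℝ} (hw : 0 < w) :
    gaussianReal 0 v {x | w < |x|} ≤ ENNReal.ofReal (v / w ^ 2) := by
  have := meas_ge_le_variance_div_sq (μ := gaussianReal 0 v) (X := id)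
    (memLp_id_gaussianReal 2) hw
  rw [variance_id_gaussianReal] at this
  refine (measure_mono fun x hx => ?_).trans this
  simpa using le_of_lt hx

/-- A linear combination of independent standard Gaussian variables is Gaussian. -/
lemma map_sum_mul_pi_gaussianReal {ι : Type*} [Fintype ι] (c : ι → ℝ) :
    (Measure.pi fun _ : ι => gaussianReal 0 1).map (fun x => ∑ j, x j * c j) =
      gaussianReal 0 (∑ j, c j ^ 2).toNNReal := by
  have hm : Measurable fun x : ι → ℝ => ∑ j, x j * c j := by fun_prop
  have := Measure.isProbabilityMeasure_map (μ := Measure.pi fun _ : ι => gaussianReal 0 1)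
    hm.aemeasurable
  refine Measure.ext_of_charFun ?_
  ext t
  rw [charFun_apply_real, integral_map hm.aemeasurable (by fun_prop), charFun_gaussianReal]
  have h1 : ∀ x : ι → ℝ, Complex.exp (t * ((∑ j, x j * c j : ℝ) : ℂ) * Complex.I) =
      ∏ j, Complex.exp (((t * c j : ℝ) : ℂ) * x j * Complex.I) := by
    intro x
    rw [← Complex.exp_sum]
    congr 1
    push_cast
    rw [Finset.mul_sum, Finset.sum_mul]
    exact Finset.sum_congr rfl fun j _ => by ring
  simp_rw [h1]
  rw [integral_fintype_prod_eq_prod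
    (f := fun j (x : ℝ) => Complex.exp (((t * c j : ℝ) : ℂ) * x * Complex.I))]
  have h2 : ∀ j, ∫ x : ℝ, Complex.exp (((t * c j : ℝ) : ℂ) * x * Complex.I) ∂gaussianReal 0 1 =
      Complex.exp (-((t * c j) ^ 2 / 2 : ℝ)) := by
    intro j
    rw [← charFun_apply_real, charFun_gaussianReal]
    congr 1
    push_cast; ring_nf
  simp_rw [h2]
  rw [← Complex.exp_sum]
  congr 1
  have h3 : (((∑ j, c j ^ 2).toNNReal : ℝ) : ℂ) = ((∑ j, c j ^ 2 : ℝ) : ℂ) := by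
    rw [Real.coe_toNNReal _ (by positivity)]
  rw [Finset.sum_neg_distrib]
  push_cast at h3 ⊢
  rw [h3, ← Finset.sum_div]
  simp_rw [mul_pow]
  rw [← Finset.mul_sum]
  ring

/-! ### One layer of the network -/

@[simp] lemma bit_sq (b : Bool) : bit b ^ 2 = 1 := by cases b <;> simp [bit]

/-- The normalised scalar product of `x` with `ω`. -/
noncomputable def avg {n : ℕ} (ω : Cube n) (x : Fin n → ℝ) : ℝ := ∑ j, x j * (bit (ω j) / √n)

@[fun_prop] lemma measurable_avg {n : ℕ} (ω : Cube n) : Measurable (avg ω) := by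
  unfold avg; fun_prop

lemma map_avg {n : ℕ} (hn : n ≠ 0) (ω : Cube n) :
    (Measure.pi fun _ => gaussianReal 0 1).map (avg ω) = gaussianReal 0 1 := by
  unfold avg
  rw [map_sum_mul_pi_gaussianReal]
  have : (n : ℝ) ≠ 0 := by exact_mod_cast hn
  simp [div_pow, this]

lemma disagreement_eq_sum {n : ℕ} (ω η : Cube n) :
    disagreement ω η = (∑ i, if ω i ≠ η i then (1 : ℝ) else 0) / n := by
  simp only [disagreement, hammingDist, Finset.sum_boole]

/-- Only the coordinates in disagreement survive, each with coefficient `±2 / √n`. -/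
lemma map_avg_sub {n : ℕ} (ω η : Cube n) :
    (Measure.pi fun _ => gaussianReal 0 1).map (fun x => avg ω x - avg η x) =
      gaussianReal 0 (4 * disagreement ω η).toNNReal := by
  have h1 : (fun x => avg ω x - avg η x) =
      fun x => ∑ j, x j * (bit (ω j) / √n - bit (η j) / √n) := by
    ext x
    simp [avg, mul_sub]
  rw [h1, map_sum_mul_pi_gaussianReal, disagreement_eq_sum, mul_div_assoc', Finset.mul_sum,
    Finset.sum_div]
  congr 2
  refine Finset.sum_congr rfl fun j _ => ?_
  rw [← sub_div, div_pow, Real.sq_sqrt (Nat.cast_nonneg n)]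
  congr 1
  cases ω j <;> cases η j <;> norm_num [bit]

lemma disagreement_nonneg {n : ℕ} (ω η : Cube n) : 0 ≤ disagreement ω η := by
  unfold disagreement; positivity

@[simp] lemma disagreement_self {n : ℕ} (ω : Cube n) : disagreement ω ω = 0 := by
  simp [disagreement]

lemma eq_of_disagreement_le_zero {n : ℕ} {ω η : Cube n} (h : disagreement ω η ≤ 0) : ω = η := by
  rcases Nat.eq_zero_or_pos n with rfl | hn
  · exact Subsingleton.elim _ _
  · have h0 := le_antisymm h (disagreement_nonneg ω η)
    have hn' : (n : ℝ) ≠ 0 := by exact_mod_cast hn.ne'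
    rw [disagreement, div_eq_zero_iff, or_iff_left hn'] at h0
    exact hammingDist_eq_zero.1 (by exact_mod_cast h0)

lemma one_div_le_disagreement {n : ℕ} {ω η : Cube n} (h : 0 < disagreement ω η) :
    1 / (n : ℝ) ≤ disagreement ω η := by
  have : 0 < hammingDist ω η := by
    by_contra h0
    simp only [not_lt, nonpos_iff_eq_zero] at h0
    simp [disagreement, h0] at h
  unfold disagreement
  gcongr
  exact_mod_cast this

lemma layer_apply {n : ℕ} (ρ : ℝ) (z : LayerNoise n) (ω : Cube n) (i : Fin n) :
    layer ρ z ω i = signBit (√ρ * avg ω z.1 + √(1 - ρ) * avg ω (z.2 i)) := by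
  have hn : 0 < √(n : ℝ) := Real.sqrt_pos.2 (by exact_mod_cast i.pos)
  have : ∑ j, weight ρ z i j * bit (ω j) =
      √n * (√ρ * avg ω z.1 + √(1 - ρ) * avg ω (z.2 i)) := by
    simp only [avg, weight, Finset.mul_sum, ← Finset.sum_add_distrib]
    refine Finset.sum_congr rfl fun j _ => ?_
    field_simp
  simp only [layer, this, signBit]
  rw [decide_eq_decide]
  exact mul_pos_iff_of_pos_left hn

/-- The values of the individual noise that may overturn the sign of a common part of size `u`. -/
def deviation (ρ u : ℝ) : Set ℝ := {x | √ρ * u ≤ √(1 - ρ) * |x|}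

lemma measurableSet_deviation (ρ u : ℝ) : MeasurableSet (deviation ρ u) :=
  measurableSet_le (by fun_prop) (by fun_prop)

lemma signBit_add_of_notMem_deviation {ρ u a b : ℝ} (hu : u ≤ |a|) (hb : b ∉ deviation ρ u) :
    signBit (√ρ * a + √(1 - ρ) * b) = signBit a := by
  simp only [deviation, Set.mem_ofPred_eq, not_le] at hb
  have h1 : |√(1 - ρ) * b| < √ρ * |a| := by
    rw [abs_mul, abs_of_nonneg (Real.sqrt_nonneg _)]
    exact hb.trans_le (by gcongr)
  have h2 := abs_lt.1 h1
  have hρ : 0 < √ρ := by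
    by_contra h
    have := le_antisymm (not_lt.1 h) (Real.sqrt_nonneg ρ)
    rw [this, zero_mul] at h1
    exact absurd h1 (not_lt.2 (abs_nonneg _))
  rw [signBit, signBit, decide_eq_decide]
  rcases le_or_gt a 0 with ha | ha
  · rw [abs_of_nonpos ha] at h2
    constructor <;> intro <;> nlinarith
  · rw [abs_of_pos ha] at h2
    constructor <;> intro <;> nlinarith

/-- A point at distance `u + w` from the origin cannot cross `0`, nor come closer to it than `u`, by
a move of length at most `w`. -/
lemma signBit_eq_of_abs_sub_le {a b u w : ℝ} (hu : 0 < u) (ha : u + w ≤ |a|)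
    (hab : |a - b| ≤ w) : u ≤ |b| ∧ signBit a = signBit b := by
  have h1 := abs_le.1 hab
  rw [signBit, signBit, decide_eq_decide]
  rcases le_or_gt a 0 with h | h
  · rw [abs_of_nonpos h] at ha
    refine ⟨by rw [abs_of_nonpos (by linarith)]; linarith, ?_⟩
    constructor <;> intro <;> linarith
  · rw [abs_of_pos h] at ha
    refine ⟨by rw [abs_of_pos (by linarith)]; linarith, ?_⟩
    constructor <;> intro <;> linarith

lemma layerLaw_fst {n : ℕ} (hn : n ≠ 0) (ω : Cube n) {s : Set ℝ} (hs : MeasurableSet s) :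
    layerLaw n {z | avg ω z.1 ∈ s} = gaussianReal 0 1 s := by
  rw [← map_avg hn ω, Measure.map_apply (by fun_prop) hs]
  exact (measurePreserving_fst (μ := Measure.pi fun _ : Fin n => gaussianReal 0 1)
    (ν := Measure.pi fun _ : Fin n => Measure.pi fun _ : Fin n => gaussianReal 0 1)).measure_preimage
    (measurable_avg ω hs).nullMeasurableSet

lemma layerLaw_fst_sub {n : ℕ} (ω η : Cube n) {s : Set ℝ} (hs : MeasurableSet s) :
    layerLaw n {z | avg ω z.1 - avg η z.1 ∈ s} =
      gaussianReal 0 (4 * disagreement ω η).toNNReal s := by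
  have hm : Measurable fun x => avg ω x - avg η x := by fun_prop
  rw [← map_avg_sub, Measure.map_apply hm hs]
  exact (measurePreserving_fst (μ := Measure.pi fun _ : Fin n => gaussianReal 0 1)
    (ν := Measure.pi fun _ : Fin n => Measure.pi fun _ : Fin n => gaussianReal 0 1)).measure_preimage
    (hm hs).nullMeasurableSet

lemma layerLaw_snd {n : ℕ} (i : Fin n) (ω : Cube n) {s : Set ℝ} (hs : MeasurableSet s) :
    layerLaw n {z | avg ω (z.2 i) ∈ s} = gaussianReal 0 1 s := by
  rw [← map_avg i.pos.ne' ω, Measure.map_apply (by fun_prop) hs]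
  have h1 := measurePreserving_snd (μ := Measure.pi fun _ : Fin n => gaussianReal 0 1)
    (ν := Measure.pi fun _ : Fin n => Measure.pi fun _ : Fin n => gaussianReal 0 1)
  have h2 := measurePreserving_eval
    (fun _ : Fin n => Measure.pi fun _ : Fin n => gaussianReal 0 1) i
  exact (h2.comp h1).measure_preimage (measurable_avg ω hs).nullMeasurableSet

lemma layerLaw_abs_sub_gt_le {n : ℕ} (ω η : Cube n) {w : ℝ} (hw : 0 < w) :
    layerLaw n {z | w < |avg ω z.1 - avg η z.1|} ≤
      ENNReal.ofReal (4 * disagreement ω η / w ^ 2) := by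
  refine (layerLaw_fst_sub ω η (s := {x | w < |x|})
    (measurableSet_lt (by fun_prop) (by fun_prop))).trans_le ?_
  refine (gaussianReal_abs_gt_le hw).trans_eq ?_
  rw [Real.coe_toNNReal _ (mul_nonneg (by norm_num) (disagreement_nonneg ω η))]

/-- Markov's inequality. Only the mean is needed, so the dependence between the noises of `ω` and of
`η` plays no role. -/
lemma layerLaw_sum_indicator_ge_le {n : ℕ} (hn : n ≠ 0) (ρ u : ℝ) (ω η : Cube n) {v : ℝ}
    (hv : 0 < v) :
    layerLaw n {z | ENNReal.ofReal v ≤ (∑ i, ((deviation ρ u).indicator 1 (avg ω (z.2 i)) +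
      (deviation ρ u).indicator 1 (avg η (z.2 i)))) / (n : ENNReal)} ≤
      2 * gaussianReal 0 1 (deviation ρ u) / ENNReal.ofReal v := by
  have hd := measurableSet_deviation ρ u
  have hm : ∀ (ω : Cube n) i, Measurable fun z : LayerNoise n =>
      (deviation ρ u).indicator (1 : ℝ → ENNReal) (avg ω (z.2 i)) := fun ω i =>
    (measurable_one.indicator hd).comp (by fun_prop)
  have hs : ∀ i, Measurable fun z : LayerNoise n =>
      (deviation ρ u).indicator (1 : ℝ → ENNReal) (avg ω (z.2 i)) +
        (deviation ρ u).indicator (1 : ℝ → ENNReal) (avg η (z.2 i)) := fun i => (hm ω i).add (hm η i)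
  have hi : ∀ (ω : Cube n) i, ∫⁻ z, (deviation ρ u).indicator (1 : ℝ → ENNReal) (avg ω (z.2 i))
      ∂layerLaw n = gaussianReal 0 1 (deviation ρ u) := fun ω i => by
    rw [← layerLaw_snd i ω hd]
    exact lintegral_indicator_one ((by fun_prop : Measurable fun z : LayerNoise n =>
      avg ω (z.2 i)) hd)
  refine (meas_ge_le_lintegral_div ?_ (by simpa using hv) ENNReal.ofReal_ne_top).trans_eq ?_
  · exact ((Finset.measurable_sum _ fun i _ => hs i).div_const _).aemeasurable
  · congr 1
    simp_rw [div_eq_mul_inv]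
    rw [lintegral_mul_const _ (Finset.measurable_sum _ fun i _ => hs i),
      lintegral_finsetSum _ fun i _ => hs i]
    simp_rw [lintegral_add_left (hm ω _), hi, ← two_mul]
    rw [Finset.sum_const, Finset.card_univ, Fintype.card_fin, nsmul_eq_mul, mul_comm, ← mul_assoc,
      ENNReal.inv_mul_cancel (by simpa using hn) (ENNReal.natCast_ne_top n), one_mul]

/-- One layer brings the proportion of disagreements up to `v` only if the common part is small,
the common parts differ much, or many individual noises are large. -/
lemma layerLaw_le_disagreement_le {n : ℕ} (hn : n ≠ 0) (ρ : ℝ) (ω η : Cube n) {u w v : ℝ}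
    (hu : 0 < u) (hw : 0 < w) (hv : 0 < v) :
    layerLaw n {z | v ≤ disagreement (layer ρ z ω) (layer ρ z η)} ≤
      gaussianReal 0 1 {x | |x| < u + w} + ENNReal.ofReal (4 * disagreement ω η / w ^ 2) +
        2 * gaussianReal 0 1 (deviation ρ u) / ENNReal.ofReal v := by
  rw [← layerLaw_fst hn ω (s := {x | |x| < u + w}) (measurableSet_lt (by fun_prop) (by fun_prop))]
  refine le_trans (measure_mono ?_) ((measure_union_le _ _).trans
    (add_le_add ((measure_union_le _ _).trans (add_le_add le_rfl (layerLaw_abs_sub_gt_le ω η hw)))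
    (layerLaw_sum_indicator_ge_le hn ρ u ω η hv)))
  intro z hz
  by_cases h1 : |avg ω z.1| < u + w
  · exact Or.inl (Or.inl h1)
  by_cases h2 : w < |avg ω z.1 - avg η z.1|
  · exact Or.inl (Or.inr h2)
  refine Or.inr ?_
  obtain ⟨h3, h4⟩ := signBit_eq_of_abs_sub_le hu (not_lt.1 h1) (not_lt.1 h2)
  have h5 : u ≤ |avg ω z.1| := by linarith [not_lt.1 h1]
  refine (ENNReal.ofReal_le_ofReal hz).trans ?_
  rw [disagreement_eq_sum, ENNReal.ofReal_div_of_pos (by positivity), ENNReal.ofReal_natCast,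
    ENNReal.ofReal_sum_of_nonneg fun i _ => by split_ifs <;> norm_num]
  gcongr with i
  by_cases h6 : avg ω (z.2 i) ∈ deviation ρ u
  · refine le_trans ?_ le_self_add
    split_ifs <;> simp [h6]
  by_cases h7 : avg η (z.2 i) ∈ deviation ρ u
  · refine le_trans ?_ le_add_self
    split_ifs <;> simp [h7]
  rw [layer_apply, layer_apply, signBit_add_of_notMem_deviation h5 h6,
    signBit_add_of_notMem_deviation h3 h7, h4]
  simp

/-! ### The Markov property of the network -/

lemma measurable_signBit : Measurable signBit :=
  measurable_to_bool <| by
    have : signBit ⁻¹' {true} = Set.Ioi 0 := by ext x; simp [signBit]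
    rw [this]; exact measurableSet_Ioi

lemma measurable_layer {n : ℕ} (ρ : ℝ) (ω : Cube n) :
    Measurable fun z : LayerNoise n => layer ρ z ω := by
  refine measurable_pi_lambda _ fun i => ?_
  simp_rw [layer_apply]
  exact measurable_signBit.comp (by fun_prop)

lemma measurableSet_layer {n : ℕ} (ρ : ℝ) (ω η : Cube n) (p : Cube n → Cube n → Prop) :
    MeasurableSet {z | p (layer ρ z ω) (layer ρ z η)} :=
  ((measurable_layer ρ ω).prodMk (measurable_layer ρ η))
    (Set.toFinite {q : Cube n × Cube n | p q.1 q.2}).measurableSet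

lemma state_succ' {n : ℕ} (ρ : ℝ) (Θ : ℕ → LayerNoise n) (ω : Cube n) (t : ℕ) :
    state ρ Θ ω (t + 1) = state ρ (fun s => Θ (s + 1)) (layer ρ (Θ 0) ω) t := by
  induction t with
  | zero => rfl
  | succ t ih => rw [state, ih, state]

lemma measurable_state {n : ℕ} (ρ : ℝ) (ω : Cube n) (t : ℕ) :
    Measurable fun Θ : ℕ → LayerNoise n => state ρ Θ ω t := by
  induction t with
  | zero => exact measurable_const
  | succ t ih =>
    have h : Measurable fun q : Cube n × LayerNoise n => layer ρ q.2 q.1 :=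
      measurable_from_prod_countable_right fun ω => measurable_layer ρ ω
    exact h.comp (ih.prodMk (measurable_pi_apply t))

lemma state_eq_of_le {n : ℕ} {ρ : ℝ} {Θ : ℕ → LayerNoise n} {ω η : Cube n} {s t : ℕ}
    (hst : s ≤ t) (h : state ρ Θ ω s = state ρ Θ η s) : state ρ Θ ω t = state ρ Θ η t := by
  induction t, hst using Nat.le_induction with
  | base => exact h
  | succ t _ ih => rw [state, state, ih]

instance (n : ℕ) : IsProbabilityMeasure (netLaw n) := by unfold netLaw; infer_instance

/-- The first layer and the remaining ones are independent, and the latter form a network. -/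
lemma measurePreserving_head_tail (n : ℕ) :
    MeasurePreserving (fun Θ : ℕ → LayerNoise n => (Θ 0, fun t => Θ (t + 1)))
      (netLaw n) ((layerLaw n).prod (netLaw n)) := by
  have hm : Measurable fun q : LayerNoise n × (ℕ → LayerNoise n) =>
      (fun t => Nat.casesOn t q.1 q.2 : ℕ → LayerNoise n) := by
    refine measurable_pi_lambda _ fun t => ?_
    cases t with
    | zero => exact measurable_fst
    | succ t => exact (measurable_pi_apply t).comp measurable_snd
  have h1 : ((layerLaw n).prod (netLaw n)).map (fun q =>
      (fun t => Nat.casesOn t q.1 q.2 : ℕ → LayerNoise n)) = netLaw n := by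
    refine Measure.eq_infinitePi _ fun s t ht => ?_
    rw [Measure.map_apply hm (MeasurableSet.pi s.countable_toSet fun i _ => ht i)]
    obtain ⟨N, hN⟩ : ∃ N, s ⊆ Finset.range (N + 1) :=
      ⟨s.sup id, fun i hi => Finset.mem_range_succ_iff.2 (Finset.le_sup (f := id) hi)⟩
    -- Padding with `univ` bases the cylinder on an initial segment, from which the factor at `0`
    -- splits off.
    set t' : ℕ → Set (LayerNoise n) := fun i => if i ∈ s then t i else Set.univ with ht'
    have hm' : ∀ i, MeasurableSet (t' i) := fun i => by
      simp only [ht']; split_ifs; exacts [ht i, .univ]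
    have h3 : ∏ i ∈ s, layerLaw n (t i) = ∏ i ∈ Finset.range (N + 1), layerLaw n (t' i) := by
      refine Finset.prod_subset_one_on_sdiff hN (fun i hi => ?_) fun i hi => ?_
      · simp [ht', (Finset.mem_sdiff.1 hi).2]
      · simp [ht', hi]
    have h4 : (fun q : LayerNoise n × (ℕ → LayerNoise n) =>
        (fun t => Nat.casesOn t q.1 q.2 : ℕ → LayerNoise n)) ⁻¹' Set.pi s t =
        t' 0 ×ˢ Set.pi (Finset.range N) fun i => t' (i + 1) := by
      ext q
      simp only [Set.mem_preimage, Set.mem_pi, Set.mem_prod, Finset.mem_coe, Finset.mem_range, ht']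
      constructor
      · refine fun h => ⟨?_, fun i _ => ?_⟩ <;> split_ifs with hi
        exacts [h 0 hi, trivial, h (i + 1) hi, trivial]
      · rintro ⟨h, h'⟩ (_ | i) hi
        · simpa [hi] using h
        · simpa [hi] using h' i (by simpa using hN hi)
    rw [h3, h4, Measure.prod_prod, netLaw, Measure.infinitePi_pi _ fun i _ => hm' _,
      Finset.prod_range_succ', mul_comm]
  have h2 : Measurable fun Θ : ℕ → LayerNoise n => (Θ 0, fun t => Θ (t + 1)) := by fun_prop
  refine ⟨h2, ?_⟩
  conv_lhs => rw [← h1, Measure.map_map h2 hm]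
  exact Measure.map_id

/-- Conditioning a property of the states on the first layer. -/
lemma netLaw_eq_lintegral {n : ℕ} (ρ : ℝ) (ω η : Cube n) (P : (ℕ → Cube n) → (ℕ → Cube n) → Prop)
    (hP : ∀ ω η, MeasurableSet {Θ | P (state ρ Θ ω) (state ρ Θ η)}) :
    netLaw n {Θ | P (fun t => state ρ Θ ω (t + 1)) fun t => state ρ Θ η (t + 1)} =
      ∫⁻ z, netLaw n {Θ | P (state ρ Θ (layer ρ z ω)) (state ρ Θ (layer ρ z η))} ∂layerLaw n := by
  have hS : MeasurableSet {q : LayerNoise n × (ℕ → LayerNoise n) |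
      P (state ρ q.2 (layer ρ q.1 ω)) (state ρ q.2 (layer ρ q.1 η))} := by
    have h : Measurable fun q : LayerNoise n × (ℕ → LayerNoise n) =>
        ((layer ρ q.1 ω, layer ρ q.1 η), q.2) :=
      (((measurable_layer ρ ω).comp measurable_fst).prodMk
        ((measurable_layer ρ η).comp measurable_fst)).prodMk measurable_snd
    have h' : MeasurableSet {q : (Cube n × Cube n) × (ℕ → LayerNoise n) |
        P (state ρ q.2 q.1.1) (state ρ q.2 q.1.2)} := by
      have : {q : (Cube n × Cube n) × (ℕ → LayerNoise n) |
          P (state ρ q.2 q.1.1) (state ρ q.2 q.1.2)} =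
          ⋃ p : Cube n × Cube n, {p} ×ˢ {Θ | P (state ρ Θ p.1) (state ρ Θ p.2)} := by
        ext ⟨p, Θ⟩; simp
      rw [this]
      exact MeasurableSet.iUnion fun p => (measurableSet_singleton p).prod (hP p.1 p.2)
    exact h h'
  have h1 := (measurePreserving_head_tail n).measure_preimage hS.nullMeasurableSet
  rw [Measure.prod_apply hS] at h1
  refine Eq.trans ?_ h1
  congr 1
  ext Θ
  simp only [state_succ']
  rfl

lemma measurableSet_state {n : ℕ} (ρ : ℝ) (ω η : Cube n) (t : ℕ) (p : Cube n → Cube n → Prop) :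
    MeasurableSet {Θ | p (state ρ Θ ω t) (state ρ Θ η t)} := by
  have := (measurable_state ρ ω t).prodMk (measurable_state ρ η t)
  exact this (Set.toFinite {q : Cube n × Cube n | p q.1 q.2}).measurableSet

/-! ### Survival and growth of the disagreements over many layers -/

/-- The event that the disagreements exceed `v` at one of the times `0, …, k`, or are still present
at time `k`. -/
def badEvent {n : ℕ} (v : ℝ) (k : ℕ) (x y : ℕ → Cube n) : Prop :=
  x k ≠ y k ∨ ∃ s ≤ k, v < disagreement (x s) (y s)

lemma measurableSet_badEvent {n : ℕ} (ρ v : ℝ) (k : ℕ) (ω η : Cube n) :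
    MeasurableSet {Θ | badEvent v k (state ρ Θ ω) (state ρ Θ η)} := by
  have : {Θ | badEvent v k (state ρ Θ ω) (state ρ Θ η)} =
      {Θ | state ρ Θ ω k ≠ state ρ Θ η k} ∪ ⋃ s : ℕ, ⋃ _ : s ≤ k,
        {Θ | v < disagreement (state ρ Θ ω s) (state ρ Θ η s)} := by
    ext Θ; simp [badEvent]
  rw [this]
  exact (measurableSet_state ρ ω η k (· ≠ ·)).union (MeasurableSet.iUnion fun s =>
    MeasurableSet.iUnion fun _ => measurableSet_state ρ ω η s fun a b => v < disagreement a b)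

/-- Induction on `k`, conditioning on the first layer. Either the level `v` is exceeded at once
(cost `e`), or the states still differ (cost `q`) and the induction hypothesis applies to the new
states. Coalesced states contribute nothing. -/
lemma netLaw_badEvent_le {n : ℕ} {ρ v : ℝ} (hv : 0 ≤ v) {e q : ENNReal}
    (he : ∀ ω η : Cube n, disagreement ω η ≤ v →
      layerLaw n {z | v < disagreement (layer ρ z ω) (layer ρ z η)} ≤ e)
    (hq : ∀ ω η : Cube n, disagreement ω η ≤ v →
      layerLaw n {z | layer ρ z ω ≠ layer ρ z η} ≤ q) (hq1 : q ≤ 1) (k : ℕ) :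
    ∀ ω η : Cube n, disagreement ω η ≤ v →
      netLaw n {Θ | badEvent v k (state ρ Θ ω) (state ρ Θ η)} ≤ k * e + q ^ k := by
  induction k with
  | zero => exact fun ω η _ => by simpa using prob_le_one
  | succ k ih =>
    intro ω η hωη
    have m1 := measurableSet_layer ρ ω η fun a b => v < disagreement a b
    have m2 := measurableSet_layer ρ ω η (· ≠ ·)
    calc netLaw n {Θ | badEvent v (k + 1) (state ρ Θ ω) (state ρ Θ η)}
        ≤ netLaw n {Θ | badEvent v k (fun t => state ρ Θ ω (t + 1))
            fun t => state ρ Θ η (t + 1)} := by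
          refine measure_mono fun Θ hΘ => ?_
          rcases hΘ with h | ⟨s, hs, h⟩
          · exact Or.inl h
          · rcases s with _ | s
            · exact absurd hωη (not_le.2 h)
            · exact Or.inr ⟨s, by omega, h⟩
      _ = ∫⁻ z, netLaw n {Θ | badEvent v k (state ρ Θ (layer ρ z ω)) (state ρ Θ (layer ρ z η))}
            ∂layerLaw n :=
          netLaw_eq_lintegral ρ ω η (badEvent v k) (measurableSet_badEvent ρ v k)
      _ ≤ ∫⁻ z, ({z | v < disagreement (layer ρ z ω) (layer ρ z η)}.indicator 1 z +
            (k * e + q ^ k) * {z | layer ρ z ω ≠ layer ρ z η}.indicator 1 z) ∂layerLaw n := by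
          refine lintegral_mono fun z => ?_
          by_cases h1 : v < disagreement (layer ρ z ω) (layer ρ z η)
          · simp only [Set.indicator_of_mem (show z ∈ {z | v < disagreement (layer ρ z ω)
              (layer ρ z η)} from h1), Pi.one_apply]
            exact prob_le_one.trans le_self_add
          by_cases h2 : layer ρ z ω = layer ρ z η
          · have : {Θ | badEvent v k (state ρ Θ (layer ρ z ω)) (state ρ Θ (layer ρ z η))} = ∅ := by
              ext Θ; simp [badEvent, h2, hv]
            simp only [this, measure_empty, zero_le]
          · simp only [Set.indicator_of_mem (show z ∈ {z | layer ρ z ω ≠ layer ρ z η} from h2),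
              Pi.one_apply, mul_one]
            exact (ih _ _ (not_lt.1 h1)).trans le_add_self
      _ = layerLaw n {z | v < disagreement (layer ρ z ω) (layer ρ z η)} +
            (k * e + q ^ k) * layerLaw n {z | layer ρ z ω ≠ layer ρ z η} := by
          rw [lintegral_add_left (measurable_one.indicator m1),
            lintegral_const_mul _ (measurable_one.indicator m2)]
          congr 1
          · exact lintegral_indicator_one m1
          · congr 1; exact lintegral_indicator_one m2
      _ ≤ e + (k * e + q ^ k) * q := by gcongr; exacts [he ω η hωη, hq ω η hωη]
      _ ≤ e + (k * e * 1 + q ^ k * q) := by rw [add_mul]; gcongr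
      _ = ((k + 1 : ℕ) : ENNReal) * e + q ^ (k + 1) := by push_cast; ring

/-- The probability that the disagreements have not died out by time `k + 1`, or exceed `v` at some
time `t ≥ 1`. -/
lemma netLaw_exists_le {n : ℕ} {ρ v : ℝ} (hv : 0 ≤ v) {e q b : ENNReal}
    (he : ∀ ω η : Cube n, disagreement ω η ≤ v →
      layerLaw n {z | v < disagreement (layer ρ z ω) (layer ρ z η)} ≤ e)
    (hq : ∀ ω η : Cube n, disagreement ω η ≤ v →
      layerLaw n {z | layer ρ z ω ≠ layer ρ z η} ≤ q) (hq1 : q ≤ 1) (k : ℕ) (ω η : Cube n)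
    (hb : layerLaw n {z | v < disagreement (layer ρ z ω) (layer ρ z η)} ≤ b) :
    netLaw n {Θ | state ρ Θ ω (k + 1) ≠ state ρ Θ η (k + 1) ∨
      ∃ t, 1 ≤ t ∧ v < disagreement (state ρ Θ ω t) (state ρ Θ η t)} ≤ b + (k * e + q ^ k) := by
  have m1 := measurableSet_layer ρ ω η fun a b => v < disagreement a b
  calc _ ≤ netLaw n {Θ | badEvent v k (fun t => state ρ Θ ω (t + 1))
            fun t => state ρ Θ η (t + 1)} := by
        refine measure_mono fun Θ hΘ => ?_
        rcases hΘ with h | ⟨s, hs, h⟩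
        · exact Or.inl h
        · obtain ⟨s, rfl⟩ := Nat.exists_eq_add_of_le' hs
          -- Times beyond `k + 1` come for free: states that agree at `k + 1` agree ever after.
          by_cases h' : state ρ Θ ω (k + 1) = state ρ Θ η (k + 1)
          · refine Or.inr ⟨s, ?_, h⟩
            by_contra h1
            rw [state_eq_of_le (by omega) h', disagreement_self] at h
            exact absurd hv (not_le.2 h)
          · exact Or.inl h'
    _ = ∫⁻ z, netLaw n {Θ | badEvent v k (state ρ Θ (layer ρ z ω)) (state ρ Θ (layer ρ z η))}
          ∂layerLaw n :=
        netLaw_eq_lintegral ρ ω η (badEvent v k) (measurableSet_badEvent ρ v k)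
    _ ≤ ∫⁻ z, ({z | v < disagreement (layer ρ z ω) (layer ρ z η)}.indicator 1 z +
          (k * e + q ^ k)) ∂layerLaw n := by
        refine lintegral_mono fun z => ?_
        by_cases h1 : v < disagreement (layer ρ z ω) (layer ρ z η)
        · simp only [Set.indicator_of_mem (show z ∈ {z | v < disagreement (layer ρ z ω)
            (layer ρ z η)} from h1), Pi.one_apply]
          exact prob_le_one.trans le_self_add
        · exact (netLaw_badEvent_le hv he hq hq1 k _ _ (not_lt.1 h1)).trans le_add_self
    _ = layerLaw n {z | v < disagreement (layer ρ z ω) (layer ρ z η)} + (k * e + q ^ k) := by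
        rw [lintegral_add_left (measurable_one.indicator m1), lintegral_const, measure_univ, mul_one]
        congr 1
        exact lintegral_indicator_one m1
    _ ≤ _ := by gcongr

/-! ### Asymptotics -/

lemma tendsto_pow_mul_exp_neg_mul (m : ℕ) {b : ℝ} (hb : 0 < b) :
    Tendsto (fun x : ℝ => x ^ m * Real.exp (-b * x)) atTop (𝓝 0) := by
  simpa using tendsto_rpow_mul_exp_neg_mul_atTop_nhds_zero m b hb

lemma tendsto_const_div_pow_atTop (c : ℝ) {m : ℕ} (hm : m ≠ 0) :
    Tendsto (fun x : ℝ => c / x ^ m) atTop (𝓝 0) :=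
  tendsto_const_nhds.div_atTop (tendsto_pow_atTop hm)

/-- The error of regime (e), `u = w = x⁻⁴` and `d = v = x⁻²⁴`, multiplied by the number `x ^ 3` of
layers. -/
lemma eventually_growth_le {γ : ℝ} (hγ : 0 < γ) :
    ∀ᶠ x : ℝ in atTop,
      x ^ 3 * (2 / x ^ 4 + 4 / x ^ 16 + 4 * Real.exp (-(17 / 2) * x ^ 3) * x ^ 24) ≤ γ := by
  have h1 := ((tendsto_const_div_pow_atTop 2 one_ne_zero).add
    (tendsto_const_div_pow_atTop 4 (m := 13) (by norm_num))).add
    ((tendsto_pow_mul_exp_neg_mul 27 (b := 17 / 2) (by norm_num)).const_mul 4)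
  simp only [mul_zero, add_zero] at h1
  filter_upwards [h1.eventually_le_const hγ, eventually_ge_atTop 1] with x hx hx1
  refine le_trans ?_ hx
  have h2 : x ≤ x ^ 3 := le_self_pow₀ hx1 (by norm_num)
  have h3 : Real.exp (-(17 / 2) * x ^ 3) ≤ Real.exp (-(17 / 2) * x) :=
    Real.exp_le_exp.2 (by linarith)
  calc _ = 2 / x ^ 1 + 4 / x ^ 13 + 4 * (x ^ 27 * Real.exp (-(17 / 2) * x ^ 3)) := by
        field_simp
    _ ≤ _ := by gcongr

/-- The Markov term of regime (b): the threshold `u = y` is fixed and the target level is `x⁻²⁴`. -/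
lemma eventually_deviation_le {γ y : ℝ} (hγ : 0 < γ) (hy : 0 < y) :
    ∀ᶠ x : ℝ in atTop, 4 * Real.exp (-(17 / 2) * y ^ 2 * x ^ 11) * x ^ 24 ≤ γ := by
  have h1 := (tendsto_pow_mul_exp_neg_mul 24 (b := 17 / 2 * y ^ 2) (by positivity)).const_mul 4
  rw [mul_zero] at h1
  filter_upwards [h1.eventually_le_const hγ, eventually_ge_atTop 1] with x hx hx1
  refine le_trans ?_ hx
  have h2 : x ≤ x ^ 11 := le_self_pow₀ hx1 (by norm_num)
  have h3 : Real.exp (-(17 / 2) * y ^ 2 * x ^ 11) ≤ Real.exp (-(17 / 2 * y ^ 2) * x) :=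
    Real.exp_le_exp.2 (by nlinarith [sq_nonneg y])
  calc _ = 4 * (x ^ 24 * Real.exp (-(17 / 2) * y ^ 2 * x ^ 11)) := by ring
    _ ≤ _ := by gcongr

lemma eventually_log_pow_le : ∀ᶠ x : ℝ in atTop, Real.log (x ^ 12) ≤ x := by
  have h := Real.isLittleO_log_id_atTop.bound (show (0 : ℝ) < 1 / 12 by norm_num)
  filter_upwards [h, eventually_ge_atTop 1] with x hx hx1
  rw [Real.norm_of_nonneg (Real.log_nonneg hx1), id, Real.norm_of_nonneg (by linarith)] at hx
  rw [Real.log_pow]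
  push_cast
  linarith

lemma eventually_log_pow_ge (c : ℝ) : ∀ᶠ x : ℝ in atTop, c ≤ Real.log (x ^ 12) :=
  (Real.tendsto_log_atTop.comp (tendsto_pow_atTop (by norm_num))).eventually_ge_atTop c

/-- A lower bound for the density of the Gaussian law near `(3/2) √(log λ / 8)`, where `λ = x ^ 12`. -/
lemma eventually_extinction_le :
    ∀ᶠ x : ℝ in atTop, ∀ u : ℝ, 0 ≤ u → u ^ 2 = Real.log (x ^ 12) / 8 →
      1 - (√(2 * Real.pi))⁻¹ * Real.exp (-(u + u / 2 + 1) ^ 2 / 2) +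
        4 * (1 / x ^ 24) / (u / 2) ^ 2 + 4 * Real.exp (-x ^ 12 / 16) ≤
      1 - (√(2 * Real.pi))⁻¹ / 2 / x ^ 2 := by
  set c := (√(2 * Real.pi))⁻¹ with hc
  have hc0 : 0 < c := by positivity
  have h1 := (tendsto_const_div_pow_atTop 16 (m := 22) (by norm_num)).add
    ((tendsto_pow_mul_exp_neg_mul 2 (b := 1 / 16) (by norm_num)).const_mul 4)
  simp only [mul_zero, add_zero] at h1
  filter_upwards [h1.eventually_le_const (half_pos hc0), eventually_ge_atTop 1,
    eventually_log_pow_ge 800] with x hx hx1 hL u hu0 hu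
  have hx0 : 0 < x := by linarith
  -- The `800` is `8 * 10 ^ 2`. For `u ≥ 10` one has `(3 u / 2 + 1) ^ 2 / 2 ≤ 4 u ^ 2 / 3`, and the
  -- right side is `log (x ^ 12) / 6`, whose exponential is `x ^ 2`.
  have hu10 : 10 ≤ u := by nlinarith
  have e1 : c / x ^ 2 ≤ c * Real.exp (-(u + u / 2 + 1) ^ 2 / 2) := by
    rw [div_eq_mul_inv]
    gcongr
    have : (x ^ 2)⁻¹ = Real.exp (-(Real.log (x ^ 12) / 6)) := by
      rw [Real.exp_neg, Real.log_pow, ← Real.exp_log (show 0 < x ^ 2 by positivity), Real.log_pow]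
      congr 2; push_cast; ring
    rw [this]
    refine Real.exp_le_exp.2 ?_
    nlinarith
  have e2 : 4 * (1 / x ^ 24) / (u / 2) ^ 2 ≤ 16 / x ^ 24 := by
    rw [div_le_iff₀ (by positivity)]
    have : 16 / x ^ 24 * (u / 2) ^ 2 = 4 * (1 / x ^ 24) * u ^ 2 := by ring
    rw [this]
    exact le_mul_of_one_le_right (by positivity) (by nlinarith)
  have e3 : Real.exp (-x ^ 12 / 16) ≤ Real.exp (-(1 / 16) * x) := by
    have h2 : x ≤ x ^ 12 := le_self_pow₀ hx1 (by norm_num)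
    exact Real.exp_le_exp.2 (by linarith)
  have e4 : (16 / x ^ 22 + 4 * (x ^ 2 * Real.exp (-(1 / 16) * x))) / x ^ 2 ≤ c / 2 / x ^ 2 := by
    gcongr
  have e5 : (16 / x ^ 22 + 4 * (x ^ 2 * Real.exp (-(1 / 16) * x))) / x ^ 2 =
      16 / x ^ 24 + 4 * Real.exp (-(1 / 16) * x) := by
    field_simp
  have e6 : c / x ^ 2 = c / 2 / x ^ 2 + c / 2 / x ^ 2 := by ring
  linarith

/-- From `k ≥ x ^ 3 - 1` one gets `k / x ^ 2 ≥ x - 1`, so the power is at most `exp (-c (x - 1))`.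
-/
lemma eventually_survival_le {γ : ℝ} (hγ : 0 < γ) {c : ℝ} (hc : 0 < c) :
    ∀ᶠ x : ℝ in atTop, ∀ k : ℕ, x ^ 3 ≤ k + 1 → (1 - c / x ^ 2) ≤ 1 ∧
      0 ≤ 1 - c / x ^ 2 ∧ (1 - c / x ^ 2) ^ k ≤ γ := by
  have h1 : Tendsto (fun x : ℝ => Real.exp (-(c * (x - 1)))) atTop (𝓝 0) := by
    refine Real.tendsto_exp_neg_atTop_nhds_zero.comp ?_
    exact (tendsto_atTop_add_const_right _ (-1) tendsto_id).const_mul_atTop hc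
  filter_upwards [h1.eventually_le_const hγ, eventually_ge_atTop 1,
    (tendsto_const_div_pow_atTop c two_ne_zero).eventually_le_const one_pos] with x hx hx1 hx2 k hk
  have h0 : 0 ≤ 1 - c / x ^ 2 := by linarith
  refine ⟨by linarith [show 0 ≤ c / x ^ 2 by positivity], h0, ?_⟩
  refine le_trans ?_ hx
  calc (1 - c / x ^ 2) ^ k ≤ Real.exp (-(c / x ^ 2)) ^ k := by
        gcongr
        linarith [Real.add_one_le_exp (-(c / x ^ 2))]
    _ = Real.exp (-(c / x ^ 2 * k)) := by rw [← Real.exp_nat_mul]; congr 1; ring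
    _ ≤ _ := by
        refine Real.exp_le_exp.2 (neg_le_neg ?_)
        rw [div_mul_eq_mul_div, le_div_iff₀ (by positivity), mul_assoc]
        refine mul_le_mul_of_nonneg_left ?_ hc.le
        nlinarith [sq_nonneg x, one_le_pow₀ hx1 (n := 2)]

/-! ### The three regimes of one layer, and their combination -/

lemma gaussianReal_deviation_le {ρ s u : ℝ} (hρ : 17 / 18 ≤ ρ) (hs : 0 < s)
    (hρs : 1 - ρ ≤ s) (hu : 0 ≤ u) :
    gaussianReal 0 1 (deviation ρ u) ≤
      ENNReal.ofReal (2 * Real.exp (-(17 / 36) * u ^ 2 / s)) := by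
  have hs' := Real.sqrt_pos.2 hs
  calc gaussianReal 0 1 (deviation ρ u) ≤ gaussianReal 0 1 {x | √ρ * u / √s ≤ |x|} := by
        refine measure_mono fun x (hx : √ρ * u ≤ √(1 - ρ) * |x|) => ?_
        refine (div_le_iff₀ hs').2 (hx.trans ?_)
        rw [mul_comm]
        gcongr
    _ ≤ _ := gaussianReal_abs_ge_le (by positivity)
    _ ≤ _ := by
        refine ENNReal.ofReal_le_ofReal ?_
        refine mul_le_mul_of_nonneg_left (Real.exp_le_exp.2 ?_) (by norm_num)
        -- The `17 / 36` is half of the lower bound `17 / 18` for `ρ`.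
        rw [div_pow, mul_pow, Real.sq_sqrt (by linarith), Real.sq_sqrt hs.le, neg_div, neg_mul,
          neg_div, div_right_comm]
        refine neg_le_neg ?_
        gcongr
        nlinarith [sq_nonneg u]

/-- The bounds on a layer in terms of the parameter `x` with `n = exp (x ^ 12)`. -/
lemma layerLaw_lt_disagreement_le {n : ℕ} (hn : n ≠ 0) {ρ x L : ℝ} (hx : 0 < x) (hL : 0 < L)
    (hρ : 17 / 18 ≤ ρ) (hρL : 1 - ρ ≤ L / (18 * x ^ 12)) {ω η : Cube n} {u w v d : ℝ}
    (hu : 0 < u) (hw : 0 < w) (hv : 0 < v) (hd : disagreement ω η ≤ d) :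
    layerLaw n {z | v < disagreement (layer ρ z ω) (layer ρ z η)} ≤
      ENNReal.ofReal (u + w + 4 * d / w ^ 2 +
        4 * Real.exp (-(17 / 2) * u ^ 2 * x ^ 12 / L) * (1 / v)) := by
  have hd0 := (disagreement_nonneg ω η).trans hd
  refine (measure_mono fun z (hz : v < _) => ?_).trans
    ((layerLaw_le_disagreement_le hn ρ ω η hu hw hv).trans ?_)
  · exact le_of_lt hz
  · rw [ENNReal.ofReal_add (by positivity) (by positivity),
      ENNReal.ofReal_add (by positivity) (by positivity)]
    have h1 := gaussianReal_deviation_le hρ (s := L / (18 * x ^ 12)) (by positivity) hρL hu.le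
    gcongr
    · exact gaussianReal_abs_lt_le _
    · calc _ ≤ 2 * ENNReal.ofReal (2 * Real.exp (-(17 / 36) * u ^ 2 / (L / (18 * x ^ 12)))) /
            ENNReal.ofReal v := by gcongr
        _ = _ := by
          rw [← ENNReal.ofReal_ofNat, ← ENNReal.ofReal_mul (by norm_num),
            ← ENNReal.ofReal_div_of_pos hv]
          congr 1
          rw [show -(17 / 36) * u ^ 2 / (L / (18 * x ^ 12)) = -(17 / 2) * u ^ 2 * x ^ 12 / L by
            field_simp; ring]
          ring

/-- Distinct states differ in a proportion at least `1 / n`, so the level `v = 1 / n` turns the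
general estimate into a bound on non-coalescence. -/
lemma layerLaw_ne_le {n : ℕ} (hn : n ≠ 0) {ρ x L : ℝ} (hx : 0 < x) (hL : 0 < L)
    (hρ : 17 / 18 ≤ ρ) (hρL : 1 - ρ ≤ L / (18 * x ^ 12)) {ω η : Cube n} {u w d : ℝ}
    (hu : 0 < u) (hw : 0 < w) (hd : disagreement ω η ≤ d) :
    layerLaw n {z | layer ρ z ω ≠ layer ρ z η} ≤
      ENNReal.ofReal (1 - (√(2 * Real.pi))⁻¹ * Real.exp (-(u + w + 1) ^ 2 / 2) + 4 * d / w ^ 2 +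
        4 * Real.exp (-(17 / 2) * u ^ 2 * x ^ 12 / L) * n) := by
  have hn' : 0 < (n : ℝ) := by positivity
  have hd0 := (disagreement_nonneg ω η).trans hd
  have hg := le_gaussianReal_abs_ge (y := u + w) (by positivity)
  have hg1 : (√(2 * Real.pi))⁻¹ * Real.exp (-(u + w + 1) ^ 2 / 2) ≤ 1 := by
    have := hg.trans prob_le_one
    rwa [← ENNReal.ofReal_one, ENNReal.ofReal_le_ofReal_iff (by norm_num)] at this
  refine (measure_mono fun z hz => ?_).trans
    ((layerLaw_le_disagreement_le hn ρ ω η hu hw (v := 1 / n) (by positivity)).trans ?_)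
  · refine one_div_le_disagreement (not_le.1 fun h => hz (eq_of_disagreement_le_zero h))
  · rw [ENNReal.ofReal_add (by have := sub_nonneg.2 hg1; positivity) (by positivity),
      ENNReal.ofReal_add (sub_nonneg.2 hg1) (by positivity)]
    have h1 := gaussianReal_deviation_le hρ (s := L / (18 * x ^ 12)) (by positivity) hρL hu.le
    gcongr
    · have : {x : ℝ | |x| < u + w} = {x | u + w ≤ |x|}ᶜ := by ext; simp
      rw [this, prob_compl_eq_one_sub (measurableSet_le (by fun_prop) (by fun_prop)),
        ENNReal.ofReal_sub _ (by positivity), ENNReal.ofReal_one]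
      gcongr
    · calc _ ≤ 2 * ENNReal.ofReal (2 * Real.exp (-(17 / 36) * u ^ 2 / (L / (18 * x ^ 12)))) /
            ENNReal.ofReal (1 / n) := by gcongr
        _ = _ := by
          rw [← ENNReal.ofReal_ofNat, ← ENNReal.ofReal_mul (by norm_num),
            ← ENNReal.ofReal_div_of_pos (by positivity)]
          congr 1
          rw [show -(17 / 36) * u ^ 2 / (L / (18 * x ^ 12)) = -(17 / 2) * u ^ 2 * x ^ 12 / L by
            field_simp; ring]
          field_simp
          ring

/-- The correlations are eventually so large that the estimates on one layer apply. -/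
lemma eventually_correlation {ρ : ℕ → ℝ} (hρ : ∀ᶠ n : ℕ in atTop,
      1 - Real.log (Real.log n) / (18 * Real.log n) < ρ n) {P : ℝ → Prop}
      (hP : ∀ᶠ x in atTop, P x) :
    ∀ᶠ n : ℕ in atTop, n ≠ 0 ∧ ∃ x : ℝ, P x ∧ 1 ≤ x ∧ x ^ 3 = (Real.log n) ^ (1 / 4 : ℝ) ∧
      (n : ℝ) = Real.exp (x ^ 12) ∧ 0 < Real.log (x ^ 12) ∧ Real.log (x ^ 12) ≤ x ∧
      17 / 18 ≤ ρ n ∧ 1 - ρ n ≤ Real.log (x ^ 12) / (18 * x ^ 12) := by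
  have hlog : Tendsto (fun n : ℕ => Real.log n) atTop atTop :=
    Real.tendsto_log_atTop.comp tendsto_natCast_atTop_atTop
  have hx : Tendsto (fun n : ℕ => Real.log n ^ (1 / 12 : ℝ)) atTop atTop :=
    (tendsto_rpow_atTop (by norm_num)).comp hlog
  filter_upwards [hρ, hx.eventually hP, hx.eventually (eventually_ge_atTop 1),
    hx.eventually eventually_log_pow_le, hx.eventually (eventually_log_pow_ge 1),
    hlog.eventually_ge_atTop 1, eventually_ne_atTop 0] with n h1 h2 h3 h4 h5 h6 h7
  have h12 : (Real.log n ^ (1 / 12 : ℝ)) ^ 12 = Real.log n := by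
    rw [← Real.rpow_natCast, ← Real.rpow_mul (by linarith)]; norm_num
  refine ⟨h7, _, h2, h3, ?_, ?_, by linarith, h4, ?_, ?_⟩
  · rw [← Real.rpow_natCast, ← Real.rpow_mul (by linarith)]; norm_num
  · rw [h12, Real.exp_log (by positivity)]
  · rw [h12] at h4 h5
    have h8 : Real.log (Real.log n) ≤ Real.log n := (Real.log_le_sub_one_of_pos (by linarith)).trans (by linarith)
    have : Real.log (Real.log n) / (18 * Real.log n) ≤ 1 / 18 := by
      rw [div_le_div_iff₀ (by linarith) (by norm_num)]; linarith
    linarith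
  · rw [h12]; linarith

/-- Two inputs with few disagreements are sent to the same state, and the proportion of
disagreements never exceeds `r`, with a probability that is bounded below uniformly. -/
lemma eventually_netLaw_le {ρ : ℕ → ℝ} (hρ : ∀ᶠ n : ℕ in atTop,
      1 - Real.log (Real.log n) / (18 * Real.log n) < ρ n) {γ : ℝ} (hγ : 0 < γ) :
    ∃ r₀ : ℝ, 0 < r₀ ∧ ∀ r : ℝ, 0 < r → r < r₀ → ∀ᶠ n : ℕ in atTop, ∀ ω η : Cube n,
      disagreement ω η < r → ∀ T : ℕ, (Real.log n) ^ (1 / 4 : ℝ) ≤ (T : ℝ) →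
      netLaw n {Θ | state (ρ n) Θ ω T ≠ state (ρ n) Θ η T ∨
        ∃ t, 1 ≤ t ∧ r < disagreement (state (ρ n) Θ ω t) (state (ρ n) Θ η t)} ≤
        ENNReal.ofReal γ := by
  set y := γ / 8 with hy
  have hy0 : 0 < y := by positivity
  have hc : 0 < (√(2 * Real.pi))⁻¹ / 2 := by positivity
  -- With `u = w = y = γ / 8` in the first layer, `u + w` and `4 r / y ^ 2` cost at most `γ / 4`
  -- each, and the Markov term another `γ / 4`. The remaining `γ / 4` is shared by growth and
  -- survival in the later layers.
  refine ⟨γ * y ^ 2 / 16, by positivity, fun r hr hr0 => ?_⟩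
  filter_upwards [eventually_correlation hρ (((((eventually_growth_le (show 0 < γ / 8 by positivity)).and
    (eventually_deviation_le (show 0 < γ / 4 by positivity) hy0)).and eventually_extinction_le).and
    (eventually_survival_le (show 0 < γ / 8 by positivity) hc)).and
    ((tendsto_const_div_pow_atTop 1 (m := 24) (by norm_num)).eventually_le_const hr))]
    with n ⟨hn, x, ⟨⟨⟨⟨h1, h2⟩, h3⟩, h4⟩, h5⟩, hx1, hx3, hxn, hL0, hLx, hρ1, hρ2⟩ ω η hωη T hT
  have hx0 : 0 < x := by linarith
  set L := Real.log (x ^ 12) with hL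
  have hLdiv : ∀ a : ℝ, 0 ≤ a → -(17 / 2) * a * x ^ 12 / L ≤ -(17 / 2) * a * x ^ 11 := by
    intro a ha
    rw [div_le_iff₀ hL0]
    have : a * x ^ 11 * L ≤ a * x ^ 11 * x := by gcongr
    nlinarith
  -- One layer to reach the level `x⁻²⁴`, then `k` layers to coalesce.
  obtain ⟨k, hk⟩ : ∃ k : ℕ, k + 1 = ⌈x ^ 3⌉₊ :=
    ⟨⌈x ^ 3⌉₊ - 1, Nat.sub_add_cancel (Nat.ceil_pos.2 (by positivity))⟩
  have hk1 : x ^ 3 ≤ k + 1 := by exact_mod_cast hk ▸ Nat.le_ceil (x ^ 3)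
  have hk2 : (k : ℝ) ≤ x ^ 3 := by
    have := Nat.ceil_lt_add_one (show 0 ≤ x ^ 3 by positivity)
    rw [← hk] at this
    push_cast at this
    linarith
  have hkT : k + 1 ≤ T := hk ▸ Nat.ceil_le.2 (hx3 ▸ hT)
  obtain ⟨h6, h7, h8⟩ := h4 k hk1
  have he : ∀ ω η : Cube n, disagreement ω η ≤ 1 / x ^ 24 →
      layerLaw n {z | 1 / x ^ 24 < disagreement (layer (ρ n) z ω) (layer (ρ n) z η)} ≤
      ENNReal.ofReal (2 / x ^ 4 + 4 / x ^ 16 + 4 * Real.exp (-(17 / 2) * x ^ 3) * x ^ 24) := by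
    intro ω η h
    refine (layerLaw_lt_disagreement_le hn hx0 hL0 hρ1 hρ2 (u := 1 / x ^ 4) (w := 1 / x ^ 4)
      (by positivity) (by positivity) (by positivity) h).trans (ENNReal.ofReal_le_ofReal ?_)
    refine add_le_add (le_of_eq (by field_simp; ring)) ?_
    rw [one_div_one_div]
    gcongr
    refine (hLdiv _ (by positivity)).trans (le_of_eq ?_)
    field_simp
  have hq : ∀ ω η : Cube n, disagreement ω η ≤ 1 / x ^ 24 →
      layerLaw n {z | layer (ρ n) z ω ≠ layer (ρ n) z η} ≤
      ENNReal.ofReal (1 - (√(2 * Real.pi))⁻¹ / 2 / x ^ 2) := by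
    intro ω η h
    -- This `u` makes the deviation exponent `(17 / 16) x ^ 12`, which beats the factor `n = exp (x
    -- ^ 12)` and leaves `exp (-x ^ 12 / 16)`. The constant `18` in the hypothesis on `ρ` gives this
    -- room.
    have hu2 : √(L / 8) ^ 2 = L / 8 := Real.sq_sqrt (by positivity)
    have hu0 : 0 < √(L / 8) := Real.sqrt_pos.2 (by positivity)
    refine (layerLaw_ne_le hn hx0 hL0 hρ1 hρ2 (u := √(L / 8)) (w := √(L / 8) / 2)
      hu0 (by positivity) h).trans (ENNReal.ofReal_le_ofReal (le_trans (le_of_eq ?_) (h3 _ hu0.le hu2)))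
    rw [hxn, mul_assoc 4, ← Real.exp_add, hu2]
    congr 3
    field_simp
    ring
  have hb : layerLaw n {z | 1 / x ^ 24 < disagreement (layer (ρ n) z ω) (layer (ρ n) z η)} ≤
      ENNReal.ofReal (3 * γ / 4) := by
    refine (layerLaw_lt_disagreement_le hn hx0 hL0 hρ1 hρ2 hy0 hy0 (by positivity)
      hωη.le).trans (ENNReal.ofReal_le_ofReal ?_)
    have e1 : 4 * r / y ^ 2 ≤ γ / 4 := by
      rw [div_le_iff₀ (by positivity)]; linarith
    have e2 : 4 * Real.exp (-(17 / 2) * y ^ 2 * x ^ 12 / L) * (1 / (1 / x ^ 24)) ≤ γ / 4 := by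
      refine le_trans ?_ h2
      rw [one_div_one_div]
      gcongr
      exact hLdiv _ (by positivity)
    linarith
  refine (measure_mono ?_).trans ((netLaw_exists_le (by positivity) he hq
    (by rw [← ENNReal.ofReal_one]; exact ENNReal.ofReal_le_ofReal h6) k ω η hb).trans ?_)
  · rintro Θ (h | ⟨t, ht, h⟩)
    · exact Or.inl fun h' => h (state_eq_of_le hkT h')
    · exact Or.inr ⟨t, ht, h5.trans_lt h⟩
  · rw [← ENNReal.ofReal_natCast, ← ENNReal.ofReal_mul (by positivity), ← ENNReal.ofReal_pow h7,
      ← ENNReal.ofReal_add (by positivity) (by positivity),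
      ← ENNReal.ofReal_add (by positivity) (by positivity)]
    refine ENNReal.ofReal_le_ofReal ?_
    have : k * (2 / x ^ 4 + 4 / x ^ 16 + 4 * Real.exp (-(17 / 2) * x ^ 3) * x ^ 24) ≤ γ / 8 :=
      le_trans (by gcongr) h1
    linarith

/-! ### Noise -/

instance (n : ℕ) (p : unitInterval) : IsProbabilityMeasure (bernoulliCube n p) := by
  unfold bernoulliCube; infer_instance

instance (n : ℕ) : IsProbabilityMeasure (uniformCube n) := by
  unfold uniformCube; infer_instance

instance (n : ℕ) (ε : unitInterval) : IsProbabilityMeasure (noisePair n ε) :=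
  Measure.isProbabilityMeasure_map (Measurable.of_discrete).aemeasurable

lemma bernoulliCube_apply_true {n : ℕ} (p : unitInterval) (i : Fin n) :
    bernoulliCube n p {b | b i = true} = ENNReal.ofReal p := by
  have h := (measurePreserving_eval (fun _ : Fin n => bernoulliMeasure true false p) i)
  have h2 := h.measure_preimage (measurableSet_singleton true).nullMeasurableSet
  refine Eq.trans ?_ (h2.trans ?_)
  · rfl
  · rw [← ENNReal.ofReal_toReal (measure_ne_top (bernoulliMeasure true false p) _)]
    congr 1
    exact bernoulliMeasure_real_apply_of_mem_of_notMem p (by measurability) (by simp) (by simp)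

/-- The disagreements are exactly the flipped bits, whose proportion has mean `ε`; Markov's
inequality. -/
lemma noisePair_le_disagreement_le {n : ℕ} (hn : n ≠ 0) (ε : unitInterval) {r : ℝ} (hr : 0 < r) :
    noisePair n ε {p | r ≤ disagreement p.1 p.2} ≤ ENNReal.ofReal (ε / r) := by
  have hn' : (n : ENNReal) ≠ 0 := by exact_mod_cast hn
  rw [noisePair, Measure.map_apply Measurable.of_discrete (Set.toFinite _).measurableSet]
  have h1 : (fun q : Cube n × Cube n => (q.1, fun i => xor (q.1 i) (q.2 i))) ⁻¹'
      {p | r ≤ disagreement p.1 p.2} ⊆ Prod.snd ⁻¹' {b : Cube n | ENNReal.ofReal r ≤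
        (∑ i, {b : Cube n | b i = true}.indicator 1 b) / (n : ENNReal)} := by
    intro q hq
    refine (ENNReal.ofReal_le_ofReal hq).trans (le_of_eq ?_)
    rw [disagreement_eq_sum, ENNReal.ofReal_div_of_pos (by positivity), ENNReal.ofReal_natCast,
      ENNReal.ofReal_sum_of_nonneg fun i _ => by split_ifs <;> norm_num]
    congr 1
    refine Finset.sum_congr rfl fun i _ => ?_
    cases h2 : q.2 i <;> simp [h2]
  refine (measure_mono h1).trans ?_
  rw [(measurePreserving_snd (μ := uniformCube n) (ν := bernoulliCube n ε)).measure_preimage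
    (Set.toFinite _).measurableSet.nullMeasurableSet]
  refine (meas_ge_le_lintegral_div Measurable.of_discrete.aemeasurable (by simpa using hr)
    ENNReal.ofReal_ne_top).trans_eq ?_
  rw [ENNReal.ofReal_div_of_pos hr]
  congr 1
  simp_rw [div_eq_mul_inv]
  rw [lintegral_mul_const _ Measurable.of_discrete,
    lintegral_finsetSum _ fun i _ => Measurable.of_discrete]
  simp_rw [lintegral_indicator_one (Set.toFinite _).measurableSet, bernoulliCube_apply_true]
  rw [Finset.sum_const, Finset.card_univ, Fintype.card_fin, nsmul_eq_mul, mul_comm, ← mul_assoc,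
    ENNReal.inv_mul_cancel hn' (ENNReal.natCast_ne_top n), one_mul]

lemma noisePair_ne_le (n : ℕ) (ε : unitInterval) :
    noisePair n ε {p | p.1 ≠ p.2} ≤ ENNReal.ofReal (n * ε) := by
  rcases eq_or_ne n 0 with rfl | hn
  · have : {p : Cube 0 × Cube 0 | p.1 ≠ p.2} = ∅ := by
      ext p; simpa using Subsingleton.elim _ _
    simp [this]
  · refine (measure_mono fun p hp => ?_).trans
      ((noisePair_le_disagreement_le hn ε (r := 1 / n) (by positivity)).trans_eq ?_)
    · exact one_div_le_disagreement (not_le.1 fun h => hp (eq_of_disagreement_le_zero h))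
    · congr 1; field_simp

lemma prod_noisePair_eq {n : ℕ} (π : Measure (BoolFn n)) [IsProbabilityMeasure π]
    (ε : unitInterval) :
    (π.prod (noisePair n ε)) {q | q.1 q.2.1 ≠ q.1 q.2.2} =
      ∫⁻ f, noisePair n ε {q | f q.1 ≠ f q.2} ∂π :=
  Measure.prod_apply (Set.toFinite _).measurableSet

lemma prod_noisePair_le {n : ℕ} (π : Measure (BoolFn n)) [IsProbabilityMeasure π]
    (ε : unitInterval) {s : Set (Cube n × Cube n)} {γ : ENNReal}
    (h : ∀ p, p ∉ s → π {f | f p.1 ≠ f p.2} ≤ γ) :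
    (π.prod (noisePair n ε)) {q | q.1 q.2.1 ≠ q.1 q.2.2} ≤ noisePair n ε s + γ := by
  rw [Measure.prod_apply_symm (Set.toFinite _).measurableSet]
  calc _ ≤ ∫⁻ p, (s.indicator 1 p + γ) ∂noisePair n ε := by
        refine lintegral_mono fun p => ?_
        by_cases hp : p ∈ s
        · rw [Set.indicator_of_mem hp]
          exact prob_le_one.trans le_self_add
        · exact (h p hp).trans le_add_self
    _ = _ := by
        rw [lintegral_add_left Measurable.of_discrete, lintegral_const, measure_univ, mul_one,
          lintegral_indicator_one (Set.toFinite _).measurableSet]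

lemma eventually_coe_unitInterval_le {c : ℝ} (hc : 0 < c) :
    ∀ᶠ ε : unitInterval in 𝓝[>] 0, (ε : ℝ) ≤ c :=
  nhdsWithin_le_nhds ((continuous_subtype_val.tendsto (0 : unitInterval)).eventually
    (eventually_le_nhds (by simpa using hc)))

/-- The supremum runs over all `n`. For large `n` the noisy pair is within `r` with high probability
and the hypothesis applies. For the finitely many other `n`, a small `ε` makes it unlikely that any
bit is flipped. -/
lemma annealedNoiseStable_of_forall {π : ∀ n, Measure (BoolFn n)}
    [∀ n, IsProbabilityMeasure (π n)]
    (h : ∀ γ : ℝ, 0 < γ → ∃ r : ℝ, 0 < r ∧ ∀ᶠ n in atTop, ∀ ω η : Cube n,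
      disagreement ω η < r → π n {f | f ω ≠ f η} ≤ ENNReal.ofReal γ) :
    AnnealedNoiseStable π := by
  refine ENNReal.tendsto_nhds_zero.2 fun δ hδ => ?_
  obtain ⟨γ, hγ, hγδ⟩ : ∃ γ : ℝ, 0 < γ ∧ ENNReal.ofReal (2 * γ) ≤ δ := by
    obtain ⟨d, hd0, hd⟩ := ENNReal.lt_iff_exists_nnreal_btwn.1 hδ
    refine ⟨d / 2, by simpa using hd0, ?_⟩
    rw [mul_div_cancel₀ _ (by norm_num)]
    simpa using hd.le
  obtain ⟨r, hr, hev⟩ := h γ hγ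
  obtain ⟨N, hN⟩ := eventually_atTop.1 hev
  filter_upwards [eventually_coe_unitInterval_le (show 0 < γ * r by positivity),
    eventually_coe_unitInterval_le (show 0 < γ / (N + 1) by positivity)] with ε h1 h2
  refine iSup_le fun n => le_trans ?_ hγδ
  rw [two_mul, ENNReal.ofReal_add hγ.le hγ.le]
  by_cases hn : n ≤ N
  · refine (prod_noisePair_le (π n) ε (s := {p | p.1 ≠ p.2}) (γ := ENNReal.ofReal γ) ?_).trans ?_
    · intro p hp
      simp [not_not.1 hp]
    · gcongr
      refine (noisePair_ne_le n ε).trans (ENNReal.ofReal_le_ofReal ?_)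
      rw [le_div_iff₀ (by positivity)] at h2
      have h3 : (n : ℝ) ≤ N + 1 := by exact_mod_cast hn.trans (Nat.le_succ N)
      nlinarith [ε.2.1]
  · refine (prod_noisePair_le (π n) ε (s := {p | r ≤ disagreement p.1 p.2})
      (γ := ENNReal.ofReal γ) ?_).trans ?_
    · exact fun p hp => hN n (not_le.1 hn).le _ _ (not_le.1 hp)
    · gcongr
      refine (noisePair_le_disagreement_le (by omega) ε hr).trans (ENNReal.ofReal_le_ofReal ?_)
      rwa [div_le_iff₀ hr]

/-- Choose `ε` with annealed probability at most `δ ^ 2`; by Markov's inequality the quenched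
probability reaches `δ` with probability at most `δ`. -/
lemma AnnealedNoiseStable.quenchedNoiseStable {π : ∀ n, Measure (BoolFn n)}
    [∀ n, IsProbabilityMeasure (π n)] (h : AnnealedNoiseStable π) : QuenchedNoiseStable π := by
  intro δ hδ
  have h1 := ENNReal.tendsto_nhds_zero.1 h (ENNReal.ofReal (δ * δ)) (by simpa using by positivity)
  have : (𝓝[>] (0 : unitInterval)).NeBot := nhdsGT_neBot_of_exists_gt ⟨1, zero_lt_one⟩
  obtain ⟨ε, h2, h3⟩ := (h1.and self_mem_nhdsWithin).exists
  refine ⟨ε, h3, fun n => ?_⟩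
  have h4 := (le_iSup (fun n => ((π n).prod (noisePair n ε)) {q | q.1 q.2.1 ≠ q.1 q.2.2}) n).trans h2
  rw [prod_noisePair_eq] at h4
  have h5 : π n {f | ENNReal.ofReal δ ≤ noisePair n ε {q | f q.1 ≠ f q.2}} ≤ ENNReal.ofReal δ := by
    refine (meas_ge_le_lintegral_div Measurable.of_discrete.aemeasurable (by simpa using hδ)
      ENNReal.ofReal_ne_top).trans ?_
    refine ENNReal.div_le_of_le_mul ?_
    rwa [← ENNReal.ofReal_mul hδ.le]
  have h6 : {f : BoolFn n | noisePair n ε {q | f q.1 ≠ f q.2} < ENNReal.ofReal δ} =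
      {f | ENNReal.ofReal δ ≤ noisePair n ε {q | f q.1 ≠ f q.2}}ᶜ := by
    ext f; simp
  rw [h6, prob_compl_eq_one_sub (Set.toFinite _).measurableSet]
  gcongr

lemma measurable_function {n : ℕ} (ρ : ℝ) (T : ℕ) (h : BoolFn n) :
    Measurable fun (Θ : ℕ → LayerNoise n) (ω : Cube n) => h (state ρ Θ ω T) :=
  measurable_pi_lambda _ fun ω => (Measurable.of_discrete (f := h)).comp (measurable_state ρ ω T)

instance (n : ℕ) (ρ : ℝ) (T : ℕ) (h : BoolFn n) : IsProbabilityMeasure (functionLaw n ρ T h) :=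
  Measure.isProbabilityMeasure_map (measurable_function ρ T h).aemeasurable

lemma functionLaw_ne_eq {n : ℕ} (ρ : ℝ) (T : ℕ) (h : BoolFn n) (ω η : Cube n) :
    functionLaw n ρ T h {f | f ω ≠ f η} =
      netLaw n {Θ | h (state ρ Θ ω T) ≠ h (state ρ Θ η T)} :=
  Measure.map_apply (measurable_function ρ T h) (Set.toFinite _).measurableSet

/-! ### Sharp thresholds -/

/-- The definition concerns sequences `p_n`; uniformity in `p` follows by applying it to a sequence
that picks a violating `p` whenever there is one. -/
lemma SharpThreshold.eventually_le {h : ∀ n, BoolFn n} (hh : SharpThreshold h) {c γ : ℝ}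
    (hc : 0 < c) (hc2 : c ≤ 1 / 2) (hγ : 0 < γ) :
    ∀ᶠ n in atTop, ∀ p : unitInterval, c ≤ |(p : ℝ) - 1 / 2| →
      bernoulliCube n p {ω | h n ω ≠ signBit ((p : ℝ) - 1 / 2)} ≤ ENNReal.ofReal γ := by
  classical
  have hex : ∀ n, ∃ p : unitInterval, c ≤ |(p : ℝ) - 1 / 2| ∧
      ((∃ p : unitInterval, c ≤ |(p : ℝ) - 1 / 2| ∧
        ENNReal.ofReal γ < bernoulliCube n p {ω | h n ω ≠ signBit ((p : ℝ) - 1 / 2)}) →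
      ENNReal.ofReal γ < bernoulliCube n p {ω | h n ω ≠ signBit ((p : ℝ) - 1 / 2)}) := by
    intro n
    by_cases hn : ∃ p : unitInterval, c ≤ |(p : ℝ) - 1 / 2| ∧
        ENNReal.ofReal γ < bernoulliCube n p {ω | h n ω ≠ signBit ((p : ℝ) - 1 / 2)}
    · obtain ⟨p, h1, h2⟩ := hn
      exact ⟨p, h1, fun _ => h2⟩
    · exact ⟨1, hc2.trans (by norm_num [abs_of_pos]), fun h' => absurd h' hn⟩
  choose p hp1 hp2 using hex
  have h1 := hh p ⟨c, hc, hp1⟩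
  have h2 : ∀ᶠ n in atTop, 1 - ENNReal.ofReal γ <
      bernoulliCube n (p n) {ω | h n ω = signBit ((p n : ℝ) - 1 / 2)} :=
    h1.eventually_const_lt (ENNReal.sub_lt_self (by simp) (by simp) (by simpa using hγ))
  filter_upwards [h2] with n hn q hq
  by_contra h3
  have h4 := hp2 n ⟨q, hq, not_le.1 h3⟩
  have h5 : {ω | h n ω ≠ signBit ((p n : ℝ) - 1 / 2)} =
      {ω | h n ω = signBit ((p n : ℝ) - 1 / 2)}ᶜ := rfl
  rw [h5, prob_compl_eq_one_sub (Set.toFinite _).measurableSet] at h4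
  exact absurd (tsub_le_iff_tsub_le.1 (le_of_lt hn)) (not_le.2 h4)

/-! ### The last layer, conditioned on its common part -/

lemma eq_bernoulliMeasure (μ : Measure Bool) [IsProbabilityMeasure μ] :
    μ = bernoulliMeasure true false ⟨μ.real {true}, measureReal_nonneg, measureReal_le_one⟩ := by
  have key : ∀ ν : Measure Bool, IsProbabilityMeasure ν → ν {false} = 1 - ν {true} := by
    intro ν _
    rw [← prob_compl_eq_one_sub (measurableSet_singleton _)]
    congr 1; ext b; cases b <;> simp
  set p : unitInterval := ⟨μ.real {true}, measureReal_nonneg, measureReal_le_one⟩ with hp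
  have ht : μ {true} = bernoulliMeasure true false p {true} := by
    have h1 : (bernoulliMeasure true false p).real {true} = p :=
      bernoulliMeasure_real_apply_of_mem_of_notMem p (measurableSet_singleton true)
        (Set.mem_singleton true) (by simp)
    rw [← ENNReal.toReal_eq_toReal_iff' (measure_ne_top _ _) (measure_ne_top _ _)]
    exact h1.symm
  refine Measure.ext_of_singleton fun b => ?_
  cases b
  · rw [key μ inferInstance, key _ inferInstance, ht]
  · exact ht

/-- The probability that a bit is `+1` when the common part of the layer has the value `a`. -/
noncomputable def bitProb (ρ a : ℝ) : unitInterval :=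
  ⟨(gaussianReal 0 1).real {b | signBit (√ρ * a + √(1 - ρ) * b) = true},
    measureReal_nonneg, measureReal_le_one⟩

lemma measurableSet_signBit (ρ a : ℝ) (c : Bool) :
    MeasurableSet {b | signBit (√ρ * a + √(1 - ρ) * b) = c} :=
  (measurable_signBit.comp (by fun_prop : Measurable fun b => √ρ * a + √(1 - ρ) * b))
    (measurableSet_singleton c)

/-- Given the common part, the bits of a layer are independent. -/
lemma map_layer_eq_bernoulliCube {n : ℕ} (hn : n ≠ 0) (ρ : ℝ) (x : Fin n → ℝ) (ω : Cube n) :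
    (Measure.pi fun _ => Measure.pi fun _ => gaussianReal 0 1).map
      (fun ψ : Fin n → Fin n → ℝ => layer ρ (x, ψ) ω) = bernoulliCube n (bitProb ρ (avg ω x)) := by
  have h1 : (fun ψ : Fin n → Fin n → ℝ => layer ρ (x, ψ) ω) =
      fun ψ i => signBit (√ρ * avg ω x + √(1 - ρ) * avg ω (ψ i)) := by
    ext ψ i; rw [layer_apply]
  have hg : Measurable fun y : Fin n → ℝ => signBit (√ρ * avg ω x + √(1 - ρ) * avg ω y) :=
    measurable_signBit.comp (by fun_prop)
  have := Measure.isProbabilityMeasure_map (μ := Measure.pi fun _ : Fin n => gaussianReal 0 1)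
    hg.aemeasurable
  rw [h1, Measure.pi_map_pi fun _ => hg.aemeasurable, bernoulliCube]
  congr 1
  ext1 i
  rw [eq_bernoulliMeasure (Measure.map _ _)]
  congr 1
  refine Subtype.ext ?_
  simp only [bitProb, measureReal_def]
  congr 1
  rw [Measure.map_apply hg (measurableSet_singleton _)]
  conv_rhs => rw [← map_avg hn ω,
    Measure.map_apply (measurable_avg ω) (measurableSet_signBit ρ _ true)]
  rfl

/-- A bit departs from the sign of `a` only on the deviation event, so its bias is at most `1 / 4`
or at least `3 / 4`. -/
lemma le_abs_bitProb_sub {ρ a u : ℝ} (hu : u ≤ |a|)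
    (hd : gaussianReal 0 1 (deviation ρ u) ≤ ENNReal.ofReal (1 / 4)) :
    1 / 4 ≤ |(bitProb ρ a : ℝ) - 1 / 2| ∧ signBit ((bitProb ρ a : ℝ) - 1 / 2) = signBit a := by
  have hd' : (gaussianReal 0 1).real (deviation ρ u) ≤ 1 / 4 :=
    ENNReal.toReal_le_of_le_ofReal (by norm_num) hd
  cases ha : signBit a
  · have : (bitProb ρ a : ℝ) ≤ 1 / 4 := by
      refine le_trans (measureReal_mono fun b hb => ?_) hd'
      by_contra h
      rw [Set.mem_ofPred_eq, signBit_add_of_notMem_deviation hu h, ha] at hb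
      exact absurd hb (by simp)
    refine ⟨by rw [abs_of_nonpos (by linarith)]; linarith, ?_⟩
    rw [signBit, decide_eq_false_iff_not]; linarith
  · have : 3 / 4 ≤ (bitProb ρ a : ℝ) := by
      have h1 : (gaussianReal 0 1).real {b | signBit (√ρ * a + √(1 - ρ) * b) = true}ᶜ ≤ 1 / 4 := by
        refine le_trans (measureReal_mono fun b hb => ?_) hd'
        by_contra h
        exact hb ((signBit_add_of_notMem_deviation hu h).trans ha)
      rw [probReal_compl_eq_one_sub (measurableSet_signBit ρ a true)] at h1
      change 3 / 4 ≤ (gaussianReal 0 1).real _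
      linarith
    refine ⟨by rw [abs_of_nonneg (by linarith)]; linarith, ?_⟩
    rw [signBit, decide_eq_true_iff]; linarith

/-- A function with a sharp threshold reads off the sign of the common part. -/
lemma layerLaw_threshold_ne_le {n : ℕ} (hn : n ≠ 0) {ρ u : ℝ} {γ : ENNReal} {h : BoolFn n}
    (hh : ∀ p : unitInterval, 1 / 4 ≤ |(p : ℝ) - 1 / 2| →
      bernoulliCube n p {ω | h ω ≠ signBit ((p : ℝ) - 1 / 2)} ≤ γ)
    (hd : gaussianReal 0 1 (deviation ρ u) ≤ ENNReal.ofReal (1 / 4)) (ω : Cube n) :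
    layerLaw n {z | u ≤ |avg ω z.1| ∧ h (layer ρ z ω) ≠ signBit (avg ω z.1)} ≤ γ := by
  have hm : MeasurableSet {z : LayerNoise n | u ≤ |avg ω z.1| ∧
      h (layer ρ z ω) ≠ signBit (avg ω z.1)} := by
    have h1 : MeasurableSet {z : LayerNoise n | u ≤ |avg ω z.1|} :=
      measurableSet_le (by fun_prop) (by fun_prop)
    refine h1.inter (measurableSet_eq_fun ?_ ?_).compl
    · exact (Measurable.of_discrete (f := h)).comp (measurable_layer ρ ω)
    · exact measurable_signBit.comp (by fun_prop)
  rw [layerLaw, Measure.prod_apply hm]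
  refine (lintegral_mono (g := fun _ => γ) fun x => ?_).trans_eq (by simp)
  by_cases hx : u ≤ |avg ω x|
  · obtain ⟨h1, h2⟩ := le_abs_bitProb_sub hx hd
    refine le_trans (le_of_eq ?_) (hh _ h1)
    have h3 : Measurable fun ψ : Fin n → Fin n → ℝ => layer ρ (x, ψ) ω :=
      (measurable_layer ρ ω).comp measurable_prodMk_left
    rw [← map_layer_eq_bernoulliCube hn, Measure.map_apply h3 (Set.toFinite _).measurableSet, h2]
    congr 1
    ext ψ
    simp [hx]
  · simp [hx]

lemma layerLaw_threshold_le {n : ℕ} (hn : n ≠ 0) {ρ u w d : ℝ} {γ : ℝ} (hγ : 0 ≤ γ) (hu : 0 < u)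
    (hw : 0 < w) {h : BoolFn n}
    (hh : ∀ p : unitInterval, 1 / 4 ≤ |(p : ℝ) - 1 / 2| →
      bernoulliCube n p {ω | h ω ≠ signBit ((p : ℝ) - 1 / 2)} ≤ ENNReal.ofReal γ)
    (hd : gaussianReal 0 1 (deviation ρ u) ≤ ENNReal.ofReal (1 / 4)) {ω η : Cube n}
    (hωη : disagreement ω η ≤ d) :
    layerLaw n {z | h (layer ρ z ω) ≠ h (layer ρ z η)} ≤
      ENNReal.ofReal (u + w + 4 * d / w ^ 2 + (γ + γ)) := by
  have hd0 := (disagreement_nonneg ω η).trans hωη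
  have h1 : layerLaw n {z | |avg ω z.1| < u + w} ≤ ENNReal.ofReal (u + w) :=
    (layerLaw_fst hn ω (s := {x | |x| < u + w})
      (measurableSet_lt (by fun_prop) (by fun_prop))).trans_le (gaussianReal_abs_lt_le _)
  have h2 : layerLaw n {z | w < |avg ω z.1 - avg η z.1|} ≤ ENNReal.ofReal (4 * d / w ^ 2) :=
    (layerLaw_abs_sub_gt_le ω η hw).trans (ENNReal.ofReal_le_ofReal (by gcongr))
  have h3 := layerLaw_threshold_ne_le hn hh hd
  rw [ENNReal.ofReal_add (by positivity) (by positivity),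
    ENNReal.ofReal_add (by positivity) (by positivity), ENNReal.ofReal_add hγ hγ]
  refine le_trans (measure_mono ?_) ((measure_union_le _ _).trans (add_le_add
    ((measure_union_le _ _).trans (add_le_add h1 h2))
    ((measure_union_le _ _).trans (add_le_add (h3 ω) (h3 η)))))
  intro z hz
  by_cases h5 : |avg ω z.1| < u + w
  · exact Or.inl (Or.inl h5)
  by_cases h6 : w < |avg ω z.1 - avg η z.1|
  · exact Or.inl (Or.inr h6)
  obtain ⟨h7, h8⟩ := signBit_eq_of_abs_sub_le hu (not_lt.1 h5) (not_lt.1 h6)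
  refine Or.inr ?_
  by_cases h9 : h (layer ρ z ω) = signBit (avg ω z.1)
  · exact Or.inr ⟨h7, fun h10 => hz (by rw [h9, h10, h8])⟩
  · exact Or.inl ⟨by linarith [not_lt.1 h5], h9⟩

/-- Conditioning is available only on the first layer, so the earlier layers are peeled off one by
one. The inputs are arbitrary: the closeness condition sits inside the event, at time `k`. -/
lemma netLaw_last_layer_le {n : ℕ} {ρ d : ℝ} {h : BoolFn n} {B : ENNReal}
    (hB : ∀ ω η : Cube n, disagreement ω η ≤ d →
      layerLaw n {z | h (layer ρ z ω) ≠ h (layer ρ z η)} ≤ B) (k : ℕ) :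
    ∀ ω η : Cube n, netLaw n {Θ | h (state ρ Θ ω (k + 1)) ≠ h (state ρ Θ η (k + 1)) ∧
      disagreement (state ρ Θ ω k) (state ρ Θ η k) ≤ d} ≤ B := by
  induction k with
  | zero =>
    intro ω η
    by_cases hd : disagreement ω η ≤ d
    · have h1 := (measurePreserving_eval_infinitePi (fun _ : ℕ => layerLaw n) 0).measure_preimage
        (measurableSet_layer ρ ω η fun a b => h a ≠ h b).nullMeasurableSet
      exact (measure_mono fun Θ hΘ => hΘ.1).trans (h1.trans_le (hB ω η hd))
    · simp [state, hd]
  | succ k ih =>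
    intro ω η
    have hm : ∀ ω η, MeasurableSet {Θ | h (state ρ Θ ω (k + 1)) ≠ h (state ρ Θ η (k + 1)) ∧
        disagreement (state ρ Θ ω k) (state ρ Θ η k) ≤ d} := fun ω η =>
      (measurableSet_state ρ ω η (k + 1) fun a b => h a ≠ h b).inter
        (measurableSet_state ρ ω η k fun a b => disagreement a b ≤ d)
    refine (netLaw_eq_lintegral ρ ω η (fun x y => h (x (k + 1)) ≠ h (y (k + 1)) ∧
      disagreement (x k) (y k) ≤ d) hm).trans_le ?_
    exact (lintegral_mono (g := fun _ => B) fun z => ih _ _).trans_eq (by simp)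

lemma SharpThreshold.eventually_netLaw_le {ρ : ℕ → ℝ} (hρ : ∀ᶠ n : ℕ in atTop,
      1 - Real.log (Real.log n) / (18 * Real.log n) < ρ n) {h : ∀ n, BoolFn n}
    (hh : SharpThreshold h) {γ : ℝ} (hγ : 0 < γ) :
    ∃ r : ℝ, 0 < r ∧ ∀ᶠ n : ℕ in atTop, ∀ ω η : Cube n, disagreement ω η < r →
      ∀ T : ℕ, 1 ≤ T → netLaw n {Θ | h n (state (ρ n) Θ ω T) ≠ h n (state (ρ n) Θ η T)} ≤
        ENNReal.ofReal γ := by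
  set y := γ / 16 with hy
  have hy0 : 0 < y := by positivity
  obtain ⟨r₀, hr₀, H⟩ := NoisyNet.eventually_netLaw_le hρ (half_pos hγ)
  set r := min (r₀ / 2) (γ * y ^ 2 / 32) with hr
  have hr0 : 0 < r := by positivity
  refine ⟨r, hr0, ?_⟩
  filter_upwards [H r hr0 ((min_le_left _ _).trans_lt (half_lt_self hr₀)),
    hh.eventually_le (c := 1 / 4) (γ := γ / 16) (by norm_num) (by norm_num) (by positivity),
    eventually_correlation hρ (eventually_deviation_le (show (0 : ℝ) < 1 / 4 by norm_num) hy0)]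
    with n h1 h2 ⟨hn, x, h3, hx1, hx3, hxn, hL0, hLx, hρ1, hρ2⟩ ω η hωη T hT
  have hx0 : 0 < x := by linarith
  have hd : gaussianReal 0 1 (deviation (ρ n) y) ≤ ENNReal.ofReal (1 / 4) := by
    refine (gaussianReal_deviation_le hρ1 (by positivity) hρ2 hy0.le).trans
      (ENNReal.ofReal_le_ofReal (le_trans ?_ h3))
    have h4 : -(17 / 36) * y ^ 2 / (Real.log (x ^ 12) / (18 * x ^ 12)) ≤
        -(17 / 2) * y ^ 2 * x ^ 11 := by
      rw [div_le_iff₀ (by positivity), mul_div_assoc', le_div_iff₀ (by positivity)]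
      have : y ^ 2 * x ^ 11 * Real.log (x ^ 12) ≤ y ^ 2 * x ^ 11 * x := by gcongr
      nlinarith
    calc _ ≤ 2 * Real.exp (-(17 / 2) * y ^ 2 * x ^ 11) := by gcongr
      _ ≤ 4 * Real.exp (-(17 / 2) * y ^ 2 * x ^ 11) * 1 := by
        nlinarith [Real.exp_pos (-(17 / 2) * y ^ 2 * x ^ 11)]
      _ ≤ _ := by gcongr; exact one_le_pow₀ hx1
  obtain ⟨k, rfl⟩ := Nat.exists_eq_add_of_le' hT
  have h5 := netLaw_last_layer_le (ρ := ρ n) (d := r) (h := h n) (fun ω η hωη =>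
    layerLaw_threshold_le hn (by positivity) hy0 hy0 h2 hd hωη) k ω η
  -- The depth used here is unrelated to `T`: only the control of the disagreements at all times `t
  -- ≥ 1` matters.
  have h6 := h1 ω η hωη ⌈Real.log n ^ (1 / 4 : ℝ)⌉₊ (Nat.le_ceil _)
  have h7 : y + y + 4 * r / y ^ 2 + (γ / 16 + γ / 16) ≤ γ / 2 := by
    have : 4 * r / y ^ 2 ≤ γ / 8 := by
      rw [div_le_iff₀ (by positivity)]
      linarith [min_le_right (r₀ / 2) (γ * y ^ 2 / 32)]
    linarith
  calc _ ≤ _ := measure_mono ?_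
    _ ≤ _ := measure_union_le _ _
    _ ≤ _ := add_le_add (h5.trans (ENNReal.ofReal_le_ofReal h7)) h6
    _ = _ := by rw [← ENNReal.ofReal_add (by positivity) (by positivity), add_halves]
  intro Θ hΘ
  by_cases h8 : disagreement (state (ρ n) Θ ω k) (state (ρ n) Θ η k) ≤ r
  · exact Or.inl ⟨hΘ, h8⟩
  · refine Or.inr (Or.inr ⟨k, ?_, not_le.1 h8⟩)
    -- Time `0` is outside that control, but there the inputs are close by assumption.
    by_contra hk
    obtain rfl : k = 0 := by omega
    exact h8 hωη.le

end NoisyNet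

/-! ### The main theorem -/

theorem mainTheorem6
    (ρ : ℕ → ℝ) (hρ : ∀ n, 0 < ρ n ∧ ρ n ≤ 1)
    (hρ_large : ∀ᶠ n : ℕ in atTop,
      1 - Real.log (Real.log n) / (18 * Real.log n) < ρ n) :
    (∀ T : ℕ → ℕ, (∀ᶠ n : ℕ in atTop, (Real.log n) ^ (1 / 4 : ℝ) ≤ (T n : ℝ)) →
      ∀ δ : ℝ, 0 < δ → ∃ ε₀ : ℝ, 0 < ε₀ ∧ ∀ ε : ℝ, 0 < ε → ε < ε₀ →
        ∀ ω η : ∀ n, NoisyNet.Cube n,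
          (∀ᶠ n in atTop, NoisyNet.disagreement (ω n) (η n) < ε ^ 2 / 2) →
          limsup (fun n => NoisyNet.netLaw n
            ({Θ | 0 < NoisyNet.disagreementProcess (ρ n) (ω n) (η n) Θ (T n)} ∪
              {Θ | ∃ t ∈ Finset.Icc 1 (T n),
                ε ^ 2 / 2 < NoisyNet.disagreementProcess (ρ n) (ω n) (η n) Θ t})) atTop
              < ENNReal.ofReal δ ∧
          limsup (fun n => NoisyNet.netLaw n
            {Θ | ∃ t : ℕ, 1 ≤ t ∧
              ε ^ 2 / 2 < NoisyNet.disagreementProcess (ρ n) (ω n) (η n) Θ t}) atTop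
              < ENNReal.ofReal δ) ∧
    (∀ (h : ∀ n, NoisyNet.BoolFn n) (T : ℕ → ℕ), (∀ n, 1 ≤ T n) →
      (NoisyNet.SharpThreshold h ∨
        ∀ᶠ n : ℕ in atTop, (Real.log n) ^ (1 / 4 : ℝ) ≤ (T n : ℝ)) →
      NoisyNet.AnnealedNoiseStable (fun n => NoisyNet.functionLaw n (ρ n) (T n) (h n)) ∧
      NoisyNet.QuenchedNoiseStable (fun n => NoisyNet.functionLaw n (ρ n) (T n) (h n))) := by
  refine ⟨fun T hT δ hδ => ?_, fun h T hT1 hT => ?_⟩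
  · obtain ⟨r₀, hr₀, H⟩ := NoisyNet.eventually_netLaw_le hρ_large (half_pos hδ)
    -- For `ε < 1` one has `ε ^ 2 / 2 < ε`, which brings the level below `r₀`.
    refine ⟨min 1 r₀, by positivity, fun ε hε hε₀ ω η hωη => ?_⟩
    have h1 : ε ^ 2 / 2 < r₀ := by
      have h2 := hε₀.trans_le (min_le_left _ _)
      have h3 := hε₀.trans_le (min_le_right _ _)
      nlinarith
    have key : ∀ᶠ n in atTop, NoisyNet.netLaw n
        {Θ | NoisyNet.state (ρ n) Θ (ω n) (T n) ≠ NoisyNet.state (ρ n) Θ (η n) (T n) ∨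
          ∃ t, 1 ≤ t ∧ ε ^ 2 / 2 < NoisyNet.disagreement (NoisyNet.state (ρ n) Θ (ω n) t)
            (NoisyNet.state (ρ n) Θ (η n) t)} ≤ ENNReal.ofReal (δ / 2) := by
      filter_upwards [H _ (by positivity) h1, hωη, hT] with n h2 h3 h4
      exact h2 _ _ h3 _ h4
    have hδ2 : ENNReal.ofReal (δ / 2) < ENNReal.ofReal δ :=
      (ENNReal.ofReal_lt_ofReal_iff hδ).2 (half_lt_self hδ)
    refine ⟨(limsup_le_of_le (by isBoundedDefault) ?_).trans_lt hδ2,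
      (limsup_le_of_le (by isBoundedDefault) ?_).trans_lt hδ2⟩
    · filter_upwards [key] with n hn
      refine (measure_mono ?_).trans hn
      rintro Θ (h2 | ⟨t, ht, h2⟩)
      · refine Or.inl fun h3 => ?_
        rw [Set.mem_ofPred_eq, NoisyNet.disagreementProcess, h3, NoisyNet.disagreement_self] at h2
        exact lt_irrefl _ h2
      · exact Or.inr ⟨t, (Finset.mem_Icc.1 ht).1, h2⟩
    · filter_upwards [key] with n hn
      exact (measure_mono fun Θ h2 => Or.inr h2).trans hn
  · have hA : NoisyNet.AnnealedNoiseStable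
        (fun n => NoisyNet.functionLaw n (ρ n) (T n) (h n)) := by
      refine NoisyNet.annealedNoiseStable_of_forall fun γ hγ => ?_
      rcases hT with hT | hT
      · obtain ⟨r, hr, H⟩ := hT.eventually_netLaw_le hρ_large hγ
        refine ⟨r, hr, ?_⟩
        filter_upwards [H] with n hn ω η hωη
        rw [NoisyNet.functionLaw_ne_eq]
        exact hn ω η hωη (T n) (hT1 n)
      · obtain ⟨r₀, hr₀, H⟩ := NoisyNet.eventually_netLaw_le hρ_large hγ
        refine ⟨r₀ / 2, half_pos hr₀, ?_⟩
        filter_upwards [H _ (half_pos hr₀) (half_lt_self hr₀), hT] with n hn hTn ω η hωη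
        rw [NoisyNet.functionLaw_ne_eq]
        refine (measure_mono fun Θ h2 => ?_).trans (hn ω η hωη (T n) hTn)
        exact Or.inl fun h3 => h2 (congrArg _ h3)
    exact ⟨hA, hA.quenchedNoiseStable⟩
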